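/- Let $k$ be a field of arbitrary characteristic and let $\Gamma$ be a finite oriented graph (loops and multiple edges allowed, not necessarily connected) with vertex set $V$ and edge set $E$, where an edge $e\in E$ goes from $\sigma(e)$ to $\tau(e)$. Let $T$ be a maximal forest of $\Gamma$, with edge set $E(T)$. A graph of Lie algebras over $\Gamma$ and $T$ consists of Lie $k$-algebras $L_v$ ($v\in V$) and $L_e$ ($e\in E$), monomorphisms of Lie algebras $\sigma_e:L_e\to L_{\sigma(e)}$ ($e\in E$) and $\tau_e:L_e\to L_{\tau(e)}$ ($e\in E(T)$), and derivations $d_e:L_e\to L_{\tau(e)}$ ($e\in E\setminus E(T)$). Put $$L_T=\Big\langle \bigcup_{v\in V} L_v \ \Big|\ \sigma_e(a)=\tau_e(a)\text{ for } e\in E(T),\ a\in L_e\Big\rangle ,$$ the free product of the $L_v$ amalgamated along the edges of $T$. That $d_e$ is a derivation means that it is $k$-linear and that $d_e([a,b])=[\sigma_e(a),d_e(b)]+[d_e(a),\sigma_e(b)]$ holds in $L_T$ for all $a,b\in L_e$. The fundamental Lie algebra of the graph of Lie algebras is $$L=\big\langle L_T,\ e\ (e\in E\setminus E(T))\ \big|\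 [e,\sigma_e(a)]=d_e(a)\text{ for } e\in E\setminus E(T),\ a\in L_e\big\rangle .$$ For a Lie algebra $M$ write $U(M)$ for its universal enveloping algebra over $k$. A ring is right coherent if each of its finitely generated right ideals is finitely presented, and right Noetherian if each of its right ideals is finitely generated. Theorem. If $U(L_v)$ is right coherent for every $v\in V$ and $U(L_e)$ is right Noetherian for every $e\in E$, then $U(L)$ is right coherent. -/

import Mathlib

universe uk uV uE uL uM

/-! ### Right coherent and right Noetherian rings -/

/-- A ring `R` is right Noetherian if `R` is Noetherian as a right module over itself. Right
`R`-modules are modules over the opposite ring `Rᵐᵒᵖ`, so the submodules involved are exactly the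
right ideals of `R`. -/
def IsRightNoetherianRing (R : Type*) [Ring R] : Prop :=
  IsNoetherian Rᵐᵒᵖ R

/-- A ring `R` is right coherent if every finitely generated right ideal of `R` is finitely
presented as a right `R`-module. -/
def IsRightCoherentRing (R : Type*) [Ring R] : Prop :=
  ∀ I : Submodule Rᵐᵒᵖ R, I.FG → Module.FinitePresentation Rᵐᵒᵖ I

/-! ### Oriented graphs and maximal forests -/

/-- An oriented graph with vertices `V` and edges `E`: every edge has a beginning and an end.
Loops and multiple edges are allowed. -/
structure OrientedGraph (V : Type uV) (E : Type uE) where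
  /-- the beginning of an edge -/
  src : E → V
  /-- the end of an edge -/
  tgt : E → V

namespace OrientedGraph

variable {V : Type uV} {E : Type uE} (G : OrientedGraph V E)

/-- Two vertices are joined by `S` if there is an unoriented path between them all of whose edges
lie in `S`. -/
def Joined (S : Set E) : V → V → Prop :=
  Relation.EqvGen fun v w => ∃ e ∈ S, G.src e = v ∧ G.tgt e = w

/-- The subgraph with all vertices of the graph and with edge set `S` is a forest: no edge of `S`
lies on a cycle of that subgraph, that is, the ends of an edge `e ∈ S` are not joined by a path
avoiding `e`. In particular `S` has no loops. -/
def IsForest (S : Set E) : Prop :=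
  ∀ e ∈ S, ¬ G.Joined (S \ {e}) (G.src e) (G.tgt e)

/-- `T` is the edge set of a maximal forest. -/
def IsMaximalForest (T : Set E) : Prop :=
  Maximal G.IsForest T

end OrientedGraph

/-! ### Lie algebras given by generators and relators -/

/-- The Lie algebra `⟨X | R⟩` given by generators `X` and relators `R`. -/
abbrev PresentedLieAlgebra (k : Type uk) [Field k] {X : Type*} (R : Set (FreeLieAlgebra k X)) :
    Type _ :=
  FreeLieAlgebra k X ⧸ LieSubmodule.lieSpan k (FreeLieAlgebra k X) R

/-! ### Graphs of Lie algebras -/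

/-- The data of a graph of Lie algebras over `k`, before it is required that the maps `d e` are
derivations: an oriented graph with a maximal forest `T`, vertex and edge Lie algebras,
monomorphisms `σ e` for all edges, monomorphisms `τ e` for the edges in `T`, and linear
maps `d e` for the edges outside `T`. -/
structure PreGraphOfLieAlgebras (k : Type uk) [Field k] (V : Type uV) (E : Type uE) extends
    OrientedGraph V E where
  /-- the edge set of the maximal forest -/
  T : Set E
  isMaximalForest : toOrientedGraph.IsMaximalForest T
  /-- the vertex Lie algebras -/
  vertexAlg : V → Type uL
  [vertexLieRing : ∀ v, LieRing (vertexAlg v)]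
  [vertexLieAlgebra : ∀ v, LieAlgebra k (vertexAlg v)]
  /-- the edge Lie algebras -/
  edgeAlg : E → Type uM
  [edgeLieRing : ∀ e, LieRing (edgeAlg e)]
  [edgeLieAlgebra : ∀ e, LieAlgebra k (edgeAlg e)]
  /-- the monomorphisms into the vertex algebra at the beginning of an edge -/
  σ : ∀ e : E, edgeAlg e →ₗ⁅k⁆ vertexAlg (src e)
  σ_injective : ∀ e, Function.Injective (σ e)
  /-- the monomorphisms into the vertex algebra at the end of an edge of the forest -/
  τ : ∀ e : {e : E // e ∈ T}, edgeAlg e →ₗ⁅k⁆ vertexAlg (tgt e)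
  τ_injective : ∀ e, Function.Injective (τ e)
  /-- the linear maps into the vertex algebra at the end of an edge outside the forest -/
  d : ∀ e : {e : E // e ∉ T}, edgeAlg e →ₗ[k] vertexAlg (tgt e)

attribute [instance] PreGraphOfLieAlgebras.vertexLieRing PreGraphOfLieAlgebras.vertexLieAlgebra
  PreGraphOfLieAlgebras.edgeLieRing PreGraphOfLieAlgebras.edgeLieAlgebra

namespace PreGraphOfLieAlgebras

variable {k : Type uk} [Field k] {V : Type uV} {E : Type uE}
  (D : PreGraphOfLieAlgebras.{uk, uV, uE, uL, uM} k V E)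

/-- For a family of maps `g v` from the vertex algebras to a Lie algebra `F`, the elements of `F`
that have to vanish for the `g v` to be homomorphisms of Lie algebras that agree on the edge
algebras of the forest. -/
inductive TreeRelator {F : Type*} [LieRing F] [LieAlgebra k F] (g : ∀ v, D.vertexAlg v → F) :
    F → Prop
  | add (v : V) (x y : D.vertexAlg v) : TreeRelator g (g v (x + y) - (g v x + g v y))
  | smul (v : V) (c : k) (x : D.vertexAlg v) : TreeRelator g (g v (c • x) - c • g v x)
  | lie (v : V) (x y : D.vertexAlg v) : TreeRelator g (g v ⁅x, y⁆ - ⁅g v x, g v y⁆)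
  | amalgam (e : {e : E // e ∈ D.T}) (a : D.edgeAlg e) :
      TreeRelator g (g (D.src e) (D.σ e a) - g (D.tgt e) (D.τ e a))

/-- The relators of `D.TreeAlg`. -/
def treeRelators : Set (FreeLieAlgebra k (Σ v, D.vertexAlg v)) :=
  {r | D.TreeRelator (fun v x => FreeLieAlgebra.of k ⟨v, x⟩) r}

/-- The Lie algebra `L_T = ⟨⋃ L_v | σ_e(a) = τ_e(a) for e ∈ E(T), a ∈ L_e⟩`: the free product of
the vertex algebras with amalgamation along the edges of the forest. Each `L_v` is presented by
its elements and its operations. -/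
abbrev TreeAlg : Type _ :=
  PresentedLieAlgebra k D.treeRelators

theorem mk_of_treeRelator {r : FreeLieAlgebra k (Σ v, D.vertexAlg v)}
    (h : D.TreeRelator (fun v x => FreeLieAlgebra.of k ⟨v, x⟩) r) :
    (LieSubmodule.Quotient.mk r : D.TreeAlg) = 0 :=
  (LieSubmodule.Quotient.mk_eq_zero _).2 (LieSubmodule.subset_lieSpan h)

/-- The canonical homomorphism `L_v → L_T`. -/
noncomputable def toTreeAlg (v : V) : D.vertexAlg v →ₗ⁅k⁆ D.TreeAlg where
  toFun x := LieSubmodule.Quotient.mk (FreeLieAlgebra.of k ⟨v, x⟩)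
  map_add' x y := sub_eq_zero.1 (D.mk_of_treeRelator (.add v x y))
  map_smul' c x := sub_eq_zero.1 (D.mk_of_treeRelator (.smul v c x))
  map_lie' := fun {x y} => sub_eq_zero.1 (D.mk_of_treeRelator (.lie v x y))

/-- The relators of `D.FundamentalAlg`: those of `L_T`, and `[e, σ_e(a)] - d_e(a)` for the edges
`e` outside the forest and `a ∈ L_e`. -/
def fundamentalRelators :
    Set (FreeLieAlgebra k ((Σ v, D.vertexAlg v) ⊕ {e : E // e ∉ D.T})) :=
  {r | D.TreeRelator (fun v x => FreeLieAlgebra.of k (Sum.inl ⟨v, x⟩)) r} ∪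
  {r | ∃ (e : {e : E // e ∉ D.T}) (a : D.edgeAlg e),
    r = ⁅(FreeLieAlgebra.of k (Sum.inr e) :
            FreeLieAlgebra k ((Σ v, D.vertexAlg v) ⊕ {e : E // e ∉ D.T})),
          FreeLieAlgebra.of k (Sum.inl ⟨D.src e, D.σ e a⟩)⁆
      - FreeLieAlgebra.of k (Sum.inl ⟨D.tgt e, D.d e a⟩)}

/-- The Lie algebra
`⟨L_T, {e} for e ∉ E(T) | [e, σ_e(a)] = d_e(a) for e ∉ E(T), a ∈ L_e⟩`. -/
abbrev FundamentalAlg : Type _ :=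
  PresentedLieAlgebra k D.fundamentalRelators

end PreGraphOfLieAlgebras

/-- A graph of Lie algebras over `k` with vertices `V` and edges `E`. For an edge `e` outside the
forest, `d e : L_e → L_{τ(e)}` is a derivation along `σ e : L_e → L_{σ(e)}`. The two vertex algebras
can be different, so the brackets in the Leibniz rule are those of `L_T`, to which both map
canonically. -/
structure GraphOfLieAlgebras (k : Type uk) [Field k] (V : Type uV) (E : Type uE) extends
    PreGraphOfLieAlgebras.{uk, uV, uE, uL, uM} k V E where
  d_lie : ∀ (e : {e : E // e ∉ T}) (a b : edgeAlg e),
    toPreGraphOfLieAlgebras.toTreeAlg (tgt e) (d e ⁅a, b⁆) =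
      ⁅toPreGraphOfLieAlgebras.toTreeAlg (src e) (σ e a),
        toPreGraphOfLieAlgebras.toTreeAlg (tgt e) (d e b)⁆ +
      ⁅toPreGraphOfLieAlgebras.toTreeAlg (tgt e) (d e a),
        toPreGraphOfLieAlgebras.toTreeAlg (src e) (σ e b)⁆

-- By Chase's criterion a ring `R` is right coherent if every power `R^J` is flat as a left module,
-- that is, if `I ⊗_R R^J → R ⊗_R R^J` is injective for every right ideal `I`. `BalancedReflecting`
-- is this injectivity for tensor products over the subalgebra generated by a set; tensor products
-- over a subalgebra are treated throughout as quotients of tensor products over `k` by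
-- `balancedSubmodule`. A right coherent subring over which `R` is free on both sides has this
-- property. If `A` is right Noetherian and `R` is free as a left `A`-module, then `M ⊗_A R^J → (M
-- ⊗_A R)^J` is injective for every right `R`-module `M`; this is `BalancedComponentwise`.
--
-- The algebra `U(L)` arises in two stages. For a tree of rings with vertex rings `C_v` and edge
-- rings `A_e` there should be an exact sequence `0 → ⨁ M ⊗_{A_e} X → ⨁ M ⊗_{C_v} X → M ⊗_R X → 0`,
-- and for stable letters `t_e` over `C` a sequence `0 → ⨁ M ⊗_{A_e} X → M ⊗_C X → M ⊗_R X → 0`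
-- whose first map is `m ⊗ x ↦ m t_e ⊗ x - m ⊗ t_e x`. With `M = R/I` and `X = R^J`, the long exact
-- sequence gives `Tor₁^R(M, X) = 0` once `Tor₁` vanishes over the `C_v` (or over `C`) and the first
-- map is injective. The Noetherian hypothesis reduces this injectivity to `X = R`.
-- `BalancedReflecting.of_tree` and `BalancedReflecting.of_stableLetters` carry out the argument on
-- elements.
--
-- For `X = R` the summand of one edge is detected by a representation. On `M × (M ⊗_A R)` the
-- diagonal action of `R` is deformed with the `A`-linear map `m ↦ m ⊗ 1`: on the vertex algebras by
-- unipotent conjugation (`exists_twist`, `exists_separating_of_conj`), on a stable letter by adding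
-- a nilpotent map (`exists_perturbation`, `exists_separating_of_add`). The deformed actions exist
-- by the universal properties of `L_T` and `L`.
--
-- The freeness statements follow from the Poincaré–Birkhoff–Witt theorem once `L_v → L_T → L` are
-- known to be injective. For this, `L_T` is made to act on a large vector space, faithfully on each
-- `L_v`, and `L` is made to act on `U(L_T)`.

attribute [local instance] LieRing.ofAssociativeRing

/-! ### The Poincaré–Birkhoff–Witt theorem by rewriting of words. -/

namespace PBW

open Module

variable {I : Type*} [LinearOrder I]

/-- The number of inversions of a word. -/
def inversions : List I → ℕ
  | [] => 0
  | a :: l => l.countP (· < a) + inversions l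

theorem inversions_swap (u v : List I) {i j : I} (h : j < i) :
    inversions (u ++ j :: i :: v) < inversions (u ++ i :: j :: v) := by
  induction u with
  | nil =>
    simp only [List.nil_append, inversions, List.countP_cons, h, not_lt_of_gt h]
    simp
    omega
  | cons a u ih =>
    simp only [List.cons_append, inversions, List.countP_append, List.countP_cons]
    omega

theorem exists_descent {w : List I} (h : ¬ w.Pairwise (· ≤ ·)) :
    ∃ u i j v, w = u ++ i :: j :: v ∧ j < i := by
  rw [← List.isChain_iff_pairwise] at h
  induction w with
  | nil => simp at h
  | cons a l ih =>
    cases l with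
    | nil => simp at h
    | cons c l =>
      rw [List.isChain_cons_cons] at h
      by_cases hac : a ≤ c
      · obtain ⟨u, i, j, v, e, hj⟩ := ih (fun h' => h ⟨hac, h'⟩)
        exact ⟨a :: u, i, j, v, by rw [e]; rfl, hj⟩
      · exact ⟨[], a, c, l, rfl, not_le.1 hac⟩

theorem not_pairwise_of_descent {u v : List I} {i j : I} (h : j < i) :
    ¬ (u ++ i :: j :: v).Pairwise (· ≤ ·) := by
  intro hp
  have := (List.pairwise_append.1 hp).2.1
  simp only [List.pairwise_cons] at this
  exact not_le_of_gt h (this.1 j (by simp))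

variable {k : Type*} [Field k] {L : Type*} [LieRing L] [LieAlgebra k L] (b : Basis I k L)

/-- A choice of an adjacent inverted pair in a word that is not sorted. -/
noncomputable def descent (w : List I) (h : ¬ w.Pairwise (· ≤ ·)) : List I × I × I × List I :=
  have h := exists_descent h
  ⟨h.choose, h.choose_spec.choose, h.choose_spec.choose_spec.choose,
    h.choose_spec.choose_spec.choose_spec.choose⟩

theorem descent_spec (w : List I) (h : ¬ w.Pairwise (· ≤ ·)) :
    w = (descent w h).1 ++ (descent w h).2.1 :: (descent w h).2.2.1 :: (descent w h).2.2.2 ∧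
      (descent w h).2.2.1 < (descent w h).2.1 :=
  (exists_descent h).choose_spec.choose_spec.choose_spec.choose_spec

theorem inversions_descent (w : List I) (h : ¬ w.Pairwise (· ≤ ·)) :
    ((descent w h).1 ++ (descent w h).2.2.1 :: (descent w h).2.1 :: (descent w h).2.2.2).length
      = w.length ∧
    inversions ((descent w h).1 ++ (descent w h).2.2.1 :: (descent w h).2.1 ::
      (descent w h).2.2.2) < inversions w := by
  have hs := descent_spec w h
  constructor
  · conv_rhs => rw [hs.1]
    simp
  · conv_rhs => rw [hs.1]
    exact inversions_swap _ _ hs.2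

theorem length_descent (w : List I) (h : ¬ w.Pairwise (· ≤ ·)) (t : I) :
    ((descent w h).1 ++ t :: (descent w h).2.2.2).length < w.length := by
  have hs := descent_spec w h
  conv_rhs => rw [hs.1]
  simp

open Classical in
/-- The normal form of a word, as a linear combination of words: adjacent inverted letters are
interchanged at the expense of their bracket. -/
noncomputable def normalForm (w : List I) : List I →₀ k :=
  if h : w.Pairwise (· ≤ ·) then Finsupp.single w 1
  else
    normalForm ((descent w h).1 ++ (descent w h).2.2.1 :: (descent w h).2.1 ::
      (descent w h).2.2.2) +
    Finsupp.linearCombination k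
      (fun t => normalForm ((descent w h).1 ++ t :: (descent w h).2.2.2))
      (b.repr ⁅b (descent w h).2.1, b (descent w h).2.2.1⁆)
termination_by (w.length, inversions w)
decreasing_by
  · rw [(inversions_descent w h).1]
    exact Prod.Lex.right _ (inversions_descent w h).2
  · exact Prod.Lex.left _ _ (length_descent w h t)

/-- The normal form of `u x v` for words `u`, `v` and an element `x` of the Lie algebra. -/
noncomputable def normalFormMid (u v : List I) : L →ₗ[k] (List I →₀ k) :=
  (Finsupp.linearCombination k fun t => normalForm b (u ++ t :: v)) ∘ₗ b.repr.toLinearMap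

theorem normalFormMid_basis (u v : List I) (i : I) :
    normalFormMid b u v (b i) = normalForm b (u ++ i :: v) := by
  simp [normalFormMid]

theorem normalForm_of_sorted {w : List I} (h : w.Pairwise (· ≤ ·)) :
    normalForm b w = Finsupp.single w 1 := by
  rw [normalForm, dif_pos h]

/-- The normal form is compatible with the interchange of two adjacent letters of `w`. -/
def Compatible (w : List I) : Prop :=
  ∀ u i j v, w = u ++ i :: j :: v →
    normalForm b w = normalForm b (u ++ j :: i :: v) + normalFormMid b u v ⁅b i, b j⁆

/-- The normal form is compatible with the interchange of two adjacent inverted letters of `w`. -/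
def DescentCompatible (w : List I) : Prop :=
  ∀ u i j v, w = u ++ i :: j :: v → j < i →
    normalForm b w = normalForm b (u ++ j :: i :: v) + normalFormMid b u v ⁅b i, b j⁆

/-- Both sides are linear in `x`, and for a basis element this is compatibility of a word shorter
than `n`. It resolves the words that carry a bracket in the overlapping case of `confluent`. -/
theorem mid_mid_left {n : ℕ} (H : ∀ w : List I, w.length < n → Compatible b w) (u v : List I)
    (hn : u.length + v.length + 2 < n) (x : L) (j : I) :
    normalFormMid b u (j :: v) x =
      normalFormMid b (u ++ [j]) v x + normalFormMid b u v ⁅x, b j⁆ := by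
  suffices h : normalFormMid b u (j :: v) =
      normalFormMid b (u ++ [j]) v + normalFormMid b u v ∘ₗ
        (-LieModule.toEnd k L L (b j)) by
    rw [h, ← lie_skew x (b j), map_neg]
    simp
  refine b.ext fun i => ?_
  rw [normalFormMid_basis, H _ (by simp; omega) u i j v rfl, ← lie_skew (b i) (b j), map_neg]
  simp [normalFormMid_basis]

/-- Two ways of resolving a word agree. -/
theorem confluent {w : List I} (H : ∀ w' : List I, w'.length < w.length → Compatible b w')
    (H' : ∀ w' : List I, w'.length = w.length → inversions w' < inversions w →
      DescentCompatible b w')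
    {u v u' v' : List I} {i j i' j' : I} (hw : w = u ++ i :: j :: v) (hij : j < i)
    (hw' : w = u' ++ i' :: j' :: v') (hij' : j' < i') (hl : u.length ≤ u'.length) :
    normalForm b (u ++ j :: i :: v) + normalFormMid b u v ⁅b i, b j⁆ =
      normalForm b (u' ++ j' :: i' :: v') + normalFormMid b u' v' ⁅b i', b j'⁆ := by
  -- The word `r` from the start of the left pair to the start of the right pair distinguishes the
  -- cases: empty for equal pairs, one letter for overlapping pairs, at least two letters for
  -- disjoint pairs.
  obtain ⟨r, rfl, hr⟩ : ∃ r, u' = u ++ r ∧ i :: j :: v = r ++ i' :: j' :: v' := by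
    obtain ⟨r, hr⟩ := List.prefix_of_prefix_length_le (l₁ := u) (l₂ := u') (l₃ := w)
      ⟨_, hw.symm⟩ ⟨_, hw'.symm⟩ hl
    refine ⟨r, hr.symm, ?_⟩
    rw [hw, ← hr, List.append_assoc] at hw'
    exact List.append_cancel_left hw'
  have hC : DescentCompatible b (u ++ j :: i :: v) := H' _ (by rw [hw]; simp) (by
    rw [hw]; exact inversions_swap _ _ hij)
  have hC' : DescentCompatible b ((u ++ r) ++ j' :: i' :: v') := H' _ (by rw [hw']; simp) (by
    rw [hw']; exact inversions_swap _ _ hij')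
  match r, hr with
  | [], hr =>
    simp only [List.nil_append, List.cons.injEq] at hr
    obtain ⟨rfl, rfl, rfl⟩ := hr
    simp
  -- Now `w` is `u i j j' v'` with `i > j > j'`. Both reductions are continued to `u j' j i v'`, and
  -- the brackets left over cancel by the Jacobi identity.
  | [a], hr =>
    simp only [List.cons_append, List.nil_append, List.cons.injEq] at hr
    obtain ⟨rfl, rfl, rfl⟩ := hr
    have e1 := hC (u ++ [j]) i j' v' (by simp) (hij'.trans hij)
    have hl1 : (u ++ j :: j' :: i :: v').length = w.length := by rw [hw]; simp
    have hi1 : inversions ((u ++ [j]) ++ j' :: i :: v') < inversions w := by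
      rw [hw]
      refine lt_trans (inversions_swap (u ++ [j]) v' (hij'.trans hij)) ?_
      simpa using inversions_swap u (j' :: v') hij
    have e2 := H' _ (by simpa using hl1) hi1 u j j' (i :: v') (by simp) hij'
    have e3 := hC' u i j' (j :: v') (by simp) (hij'.trans hij)
    have hi3 : inversions (u ++ j' :: i :: j :: v') < inversions w := by
      rw [hw']
      refine lt_trans (inversions_swap u (j :: v') (hij'.trans hij)) ?_
      simpa using inversions_swap (u ++ [i]) v' hij'
    have e4 := H' _ (by rw [hw]; simp) hi3 (u ++ [j']) i j v' (by simp) hij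
    have hlen : u.length + v'.length + 2 < w.length := by rw [hw]; simp; omega
    have f1 := mid_mid_left b H u v' hlen ⁅b i, b j⁆ j'
    have f2 := mid_mid_left b H u v' hlen ⁅b j, b j'⁆ i
    have f3 := mid_mid_left b H u v' hlen ⁅b i, b j'⁆ j
    have jac : ⁅⁅b i, b j⁆, b j'⁆ + ⁅⁅b j, b j'⁆, b i⁆ - ⁅⁅b i, b j'⁆, b j⁆ = 0 := by
      rw [lie_lie (b i) (b j) (b j'), ← lie_skew ⁅b j, b j'⁆ (b i),
        ← lie_skew ⁅b i, b j'⁆ (b j)]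
      abel
    have jac' := congrArg (normalFormMid b u v') jac
    simp only [map_add, map_sub, map_zero] at jac'
    simp only [List.append_assoc, List.cons_append, List.nil_append] at *
    rw [e1, e2, e3, e4, f1, f2, f3]
    rw [← sub_eq_zero] at jac' ⊢
    rw [← jac']
    abel
  | a :: c :: r, hr =>
    simp only [List.cons_append, List.cons.injEq] at hr
    obtain ⟨rfl, rfl, rfl⟩ := hr
    have e1 := hC (u ++ j :: i :: r) i' j' v' (by simp) hij'
    have e2 := hC' u i j (r ++ j' :: i' :: v') (by simp) hij
    have hlen : u.length + r.length + v'.length + 4 = w.length := by rw [hw]; simp; omega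
    -- The pairs are disjoint. `B x y` is the normal form of `u x r y v'`, bilinear in two elements
    -- of `L`; both orders of reduction produce the same term with a bracket in each place.
    let B : L →ₗ[k] L →ₗ[k] (List I →₀ k) :=
      (Finsupp.linearCombination k fun t => normalFormMid b (u ++ t :: r) v') ∘ₗ b.repr.toLinearMap
    have hB₁ (t : I) : B (b t) = normalFormMid b (u ++ t :: r) v' := by simp [B]
    have hB₂ (x : L) (s : I) : B x (b s) = normalFormMid b u (r ++ s :: v') x := by
      refine DFunLike.congr_fun (f := B.flip (b s)) (b.ext fun t => ?_) x
      simp [hB₁, normalFormMid_basis]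
    have g1 (x : L) : normalFormMid b u (r ++ i' :: j' :: v') x =
        normalFormMid b u (r ++ j' :: i' :: v') x + B x ⁅b i', b j'⁆ := by
      refine DFunLike.congr_fun (f := normalFormMid b u (r ++ i' :: j' :: v'))
        (g := normalFormMid b u (r ++ j' :: i' :: v') + B.flip ⁅b i', b j'⁆)
        (b.ext fun t => ?_) x
      simp only [LinearMap.add_apply, LinearMap.flip_apply, hB₁, normalFormMid_basis]
      have := H (u ++ t :: (r ++ i' :: j' :: v')) (by simp; omega) (u ++ t :: r) i' j' v'
        (by simp)
      simpa using this
    have g2 (y : L) : normalFormMid b (u ++ i :: j :: r) v' y =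
        normalFormMid b (u ++ j :: i :: r) v' y + B ⁅b i, b j⁆ y := by
      refine DFunLike.congr_fun (f := normalFormMid b (u ++ i :: j :: r) v')
        (g := normalFormMid b (u ++ j :: i :: r) v' + B ⁅b i, b j⁆)
        (b.ext fun s => ?_) y
      simp only [LinearMap.add_apply, hB₂, normalFormMid_basis]
      have := H (u ++ i :: j :: (r ++ s :: v')) (by simp; omega) u i j (r ++ s :: v') (by simp)
      simpa using this
    simp only [List.append_assoc, List.cons_append] at *
    rw [e1, e2, g1, g2]
    abel

/-- Diamond lemma: induction on the length, and for fixed length on the inversions. The pair chosen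
by `normalForm` and an arbitrary inverted pair give the same result by `confluent`; an ascending
pair is an inverted pair of the swapped word, and equal letters have bracket zero. -/
theorem compatible (w : List I) : Compatible b w := by
  induction h : w.length using Nat.strong_induction_on generalizing w with
  | _ n ihn =>
  subst h
  have H : ∀ w' : List I, w'.length < w.length → Compatible b w' := fun w' hw' => ihn _ hw' _ rfl
  have D : ∀ (m : ℕ) (w' : List I), w'.length = w.length → inversions w' = m →
      DescentCompatible b w' := by
    intro m
    induction m using Nat.strong_induction_on with
    | _ m ihm =>
    intro w' hl hm u i j v hw hij
    have H₁ : ∀ w'' : List I, w''.length < w'.length → Compatible b w'' :=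
      fun w'' hw'' => H _ (hl ▸ hw'')
    have H₂ : ∀ w'' : List I, w''.length = w'.length → inversions w'' < inversions w' →
        DescentCompatible b w'' :=
      fun w'' h₁ h₂ => ihm _ (hm ▸ h₂) _ (h₁.trans hl) rfl
    have hs : ¬ w'.Pairwise (· ≤ ·) := hw ▸ not_pairwise_of_descent hij
    have hd := descent_spec w' hs
    rw [normalForm, dif_neg hs]
    change _ + normalFormMid b _ _ _ = _
    rcases le_total (descent w' hs).1.length u.length with hle | hle
    · exact confluent b H₁ H₂ hd.1 hd.2 hw hij hle
    · exact (confluent b H₁ H₂ hw hij hd.1 hd.2 hle).symm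
  intro u i j v hw
  rcases lt_trichotomy i j with hij | rfl | hij
  · rw [D _ (u ++ j :: i :: v) (by rw [hw]; simp) rfl u j i v rfl hij, ← hw,
      ← lie_skew (b i) (b j), map_neg]
    simp
  · simp [hw]
  · exact D _ w rfl rfl u i j v hw hij

/-- The action of a basis element on words. -/
noncomputable def letterAction (i : I) : Module.End k (List I →₀ k) :=
  Finsupp.linearCombination k fun w => normalForm b (i :: w)

theorem normalFormMid_cons (i : I) (u v : List I) (x : L)
    (h : ∀ t, letterAction b i (normalForm b (u ++ t :: v)) = normalForm b (i :: (u ++ t :: v))) :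
    letterAction b i (normalFormMid b u v x) = normalFormMid b (i :: u) v x := by
  refine DFunLike.congr_fun (f := letterAction b i ∘ₗ normalFormMid b u v) (b.ext fun t => ?_) x
  simp [normalFormMid_basis, h]

/-- For a sorted word this is the definition of the action, since such a word is its own normal
form. In general both sides obey the same interchange rule, by `compatible`, so induction on length
and inversions applies. -/
theorem letterAction_normalForm (i : I) (w : List I) :
    letterAction b i (normalForm b w) = normalForm b (i :: w) := by
  induction hn : w.length using Nat.strong_induction_on generalizing w with
  | _ n ihn =>
  induction hm : inversions w using Nat.strong_induction_on generalizing w with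
  | _ m ihm =>
  by_cases h : w.Pairwise (· ≤ ·)
  · simp [normalForm_of_sorted b h, letterAction]
  · obtain ⟨u, a, c, v, rfl, hca⟩ := exists_descent h
    rw [compatible b _ u a c v rfl, compatible b (i :: (u ++ a :: c :: v)) (i :: u) a c v rfl,
      map_add, ihm _ (hm ▸ inversions_swap u v hca) _ (by simpa using hn) rfl,
      normalFormMid_cons b i u v _ fun t => ihn _ (by rw [← hn]; simp) _ rfl]
    rfl

/-- The action of the Lie algebra on words. -/
noncomputable def wordAction : L →ₗ⁅k⁆ Module.End k (List I →₀ k) :=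
  { b.constr k (letterAction b) with
    map_lie' := by
      intro x y
      let f : L →ₗ[k] Module.End k (List I →₀ k) := b.constr k (letterAction b)
      have hf (i : I) : f (b i) = letterAction b i := b.constr_basis k _ i
      change f ⁅x, y⁆ = f x * f y - f y * f x
      -- Both sides are bilinear, so the identity is checked on basis elements and then on words,
      -- where it is compatibility at the first two letters.
      suffices h : LinearMap.mk₂ k (fun x y => f ⁅x, y⁆) (by simp) (by simp) (by simp) (by simp) =
          LinearMap.mk₂ k (fun x y => f x * f y - f y * f x) (by intros; simp; noncomm_ring)
            (by intros; ext; simp [mul_sub]) (by intros; simp; noncomm_ring)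
            (by intros; ext; simp [mul_sub]) from
        DFunLike.congr_fun (DFunLike.congr_fun h x) y
      refine b.ext fun i => b.ext fun j => Finsupp.lhom_ext' fun w => LinearMap.ext_ring ?_
      change f ⁅b i, b j⁆ (Finsupp.single w 1) =
        (f (b i) * f (b j) - f (b j) * f (b i)) (Finsupp.single w 1)
      rw [hf, hf]
      have h₁ (i : I) : letterAction b i (Finsupp.single w 1) = normalForm b (i :: w) := by
        simp [letterAction]
      have h₂ (x : L) : f x (Finsupp.single w 1) = normalFormMid b [] w x := by
        refine DFunLike.congr_fun (f := LinearMap.applyₗ (Finsupp.single w 1) ∘ₗ f)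
          (b.ext fun t => ?_) x
        simp [normalFormMid_basis, hf, h₁]
      rw [h₂]
      simp only [LinearMap.sub_apply, Module.End.mul_apply, h₁, letterAction_normalForm]
      rw [compatible b (i :: j :: w) [] i j w rfl]
      simp }

theorem wordAction_basis (i : I) : wordAction b (b i) = letterAction b i :=
  b.constr_basis k _ i

open UniversalEnvelopingAlgebra

/-- The product of the letters of a word in the universal enveloping algebra. -/
noncomputable def monomial (w : List I) : UniversalEnvelopingAlgebra k L :=
  (w.map fun i => ι k (b i)).prod

omit [LinearOrder I] in
theorem monomial_append (u v : List I) : monomial b (u ++ v) = monomial b u * monomial b v := by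
  simp [monomial]

theorem lift_monomial (w : List I) :
    lift k (wordAction b) (monomial b w) (Finsupp.single [] 1) = normalForm b w := by
  induction w with
  | nil => simp [monomial, normalForm_of_sorted]
  | cons i w ih =>
    rw [monomial, List.map_cons, List.prod_cons, ← monomial, map_mul, Module.End.mul_apply, ih,
      lift_ι_apply, wordAction_basis, letterAction_normalForm]

/-- Acting on the empty word sends the monomial of a word to its normal form, and distinct sorted
words are distinct basis vectors. -/
theorem linearIndependent_monomial :
    LinearIndependent k fun w : {w : List I // w.Pairwise (· ≤ ·)} => monomial b w.1 := by
  refine LinearIndependent.of_comp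
    (LinearMap.applyₗ (Finsupp.single [] 1) ∘ₗ (lift k (wordAction b)).toLinearMap) ?_
  have : (⇑(LinearMap.applyₗ (Finsupp.single [] 1) ∘ₗ (lift k (wordAction b)).toLinearMap) ∘
      fun w : {w : List I // w.Pairwise (· ≤ ·)} => monomial b w.1) =
      (fun w : List I => Finsupp.single w (1 : k)) ∘ Subtype.val := by
    funext w
    change lift k (wordAction b) (monomial b w.1) (Finsupp.single [] 1) = _
    rw [lift_monomial, normalForm_of_sorted b w.2]
    rfl
  rw [this]
  exact (Finsupp.linearIndependent_single_one k (List I)).comp _ Subtype.val_injective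

/-- The universal property yields a map into the adjoined subalgebra, and composing it with the
inclusion gives the identity. -/
theorem adjoin_range_ι :
    Algebra.adjoin k (Set.range (ι k : L → UniversalEnvelopingAlgebra k L)) = ⊤ := by
  let S := Algebra.adjoin k (Set.range (ι k : L → UniversalEnvelopingAlgebra k L))
  let f : L →ₗ⁅k⁆ S :=
    { toFun := fun x => ⟨ι k x, Algebra.subset_adjoin ⟨x, rfl⟩⟩
      map_add' := fun x y => Subtype.ext (map_add _ _ _)
      map_smul' := fun c x => Subtype.ext (map_smul _ _ _)
      map_lie' := fun {x y} => Subtype.ext ((ι k).map_lie x y) }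
  have h : S.val.comp (lift k f) = AlgHom.id k _ := by
    refine hom_ext k (LieHom.ext fun x => ?_)
    change (lift k f (ι k x) : UniversalEnvelopingAlgebra k L) = ι k x
    rw [lift_ι_apply]
    rfl
  refine eq_top_iff.2 fun x _ => ?_
  rw [← AlgHom.id_apply (R := k) x, ← h]
  exact (lift k f x).2

/-- Interchanging inverted letters costs only shorter words, so sorted monomials span all monomials.
Their span is stable under left multiplication by the generators and contains `1`. -/
theorem span_monomial :
    Submodule.span k (Set.range fun w : {w : List I // w.Pairwise (· ≤ ·)} => monomial b w.1) =
      ⊤ := by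
  set P := Submodule.span k (Set.range fun w : {w : List I // w.Pairwise (· ≤ ·)} => monomial b w.1)
  have hm (w : List I) : monomial b w ∈ P := by
    induction hn : w.length using Nat.strong_induction_on generalizing w with
    | _ n ihn =>
    induction hm : inversions w using Nat.strong_induction_on generalizing w with
    | _ m ihm =>
    by_cases h : w.Pairwise (· ≤ ·)
    · exact Submodule.subset_span ⟨⟨w, h⟩, rfl⟩
    · obtain ⟨u, i, j, v, rfl, hij⟩ := exists_descent h
      have hmid (x : L) : monomial b u * ι k x * monomial b v ∈ P := by
        induction b.mem_span x using Submodule.span_induction with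
        | mem x hx =>
          obtain ⟨t, rfl⟩ := hx
          have := ihn _ (by rw [← hn]; simp) (u ++ t :: v) rfl
          rwa [monomial_append, monomial, monomial, List.map_cons, List.prod_cons, ← mul_assoc]
            at this
        | zero => simp
        | add x y _ _ hx hy => simpa [mul_add, add_mul] using P.add_mem hx hy
        | smul c x _ hx => simpa using P.smul_mem c hx
      have e : monomial b (u ++ i :: j :: v) = monomial b (u ++ j :: i :: v) +
          monomial b u * ι k ⁅b i, b j⁆ * monomial b v := by
        rw [LieHom.map_lie, Ring.lie_def]
        simp only [monomial_append]
        simp only [monomial, List.map_cons, List.prod_cons]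
        noncomm_ring
      rw [e]
      exact P.add_mem (ihm _ (hm ▸ inversions_swap u v hij) _ (by simpa using hn) rfl) (hmid _)
  rw [Submodule.eq_top_iff']
  intro x
  have hx : x ∈ Algebra.adjoin k (Set.range (ι k : L → UniversalEnvelopingAlgebra k L)) := by
    rw [adjoin_range_ι]; trivial
  suffices h : ∀ y ∈ P, x * y ∈ P by simpa using h 1 (by simpa [monomial] using hm [])
  induction hx using Algebra.adjoin_induction with
  | mem x hx =>
    obtain ⟨x, rfl⟩ := hx
    intro y hy
    induction hy using Submodule.span_induction with
    | mem y hy =>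
      obtain ⟨w, rfl⟩ := hy
      induction b.mem_span x using Submodule.span_induction with
      | mem x hx =>
        obtain ⟨i, rfl⟩ := hx
        simpa [monomial] using hm (i :: w.1)
      | zero => simp
      | add x y _ _ hx hy => simpa [add_mul] using P.add_mem hx hy
      | smul c x _ hx => simpa using P.smul_mem c hx
    | zero => simp
    | add y z _ _ hy hz => simpa [mul_add] using P.add_mem hy hz
    | smul c y _ hy => simpa using P.smul_mem c hy
  | algebraMap c =>
    intro y hy
    rw [← Algebra.smul_def]
    exact P.smul_mem c hy
  | add x y _ _ hx hy => exact fun z hz => by rw [add_mul]; exact P.add_mem (hx z hz) (hy z hz)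
  | mul x y _ _ hx hy => exact fun z hz => by rw [mul_assoc]; exact hx _ (hy z hz)

/-- The Poincaré–Birkhoff–Witt basis. -/
noncomputable def basis :
    Basis {w : List I // w.Pairwise (· ≤ ·)} k (UniversalEnvelopingAlgebra k L) :=
  Basis.mk (linearIndependent_monomial b) (span_monomial b).ge

theorem basis_apply (w : {w : List I // w.Pairwise (· ≤ ·)}) : basis b w = monomial b w.1 := by
  simp [basis]

end PBW

/-! ### Freeness of enveloping algebras over subalgebras. -/

open Module

/-- `R` is free as a left module over `A`, by way of the homomorphism `f`. -/
def IsLeftFreeAlong.{w, uk', ua, ur} {k : Type uk'} [Field k] {A : Type ua} {R : Type ur} [Ring A]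
    [Ring R] [Algebra k A] [Algebra k R] (f : A →ₐ[k] R) : Prop :=
  ∃ (ι : Type w) (b : ι → R), Function.Bijective fun c : ι →₀ A => c.sum fun i a => f a * b i

/-- `R` is free as a right module over `A`, by way of the homomorphism `f`. -/
def IsRightFreeAlong.{w, uk', ua, ur} {k : Type uk'} [Field k] {A : Type ua} {R : Type ur} [Ring A]
    [Ring R] [Algebra k A] [Algebra k R] (f : A →ₐ[k] R) : Prop :=
  ∃ (ι : Type w) (b : ι → R), Function.Bijective fun c : ι →₀ A => c.sum fun i a => b i * f a

namespace PBW

open UniversalEnvelopingAlgebra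

section Block

variable {I₁ I₂ : Type*} [LinearOrder I₁] [LinearOrder I₂]

theorem pairwise_map_inl_append_map_inr {w₁ : List I₁} {w₂ : List I₂} :
    (w₁.map Sum.inlₗ ++ w₂.map Sum.inrₗ : List (I₁ ⊕ₗ I₂)).Pairwise (· ≤ ·) ↔
      w₁.Pairwise (· ≤ ·) ∧ w₂.Pairwise (· ≤ ·) := by
  simp [List.pairwise_append, List.pairwise_map]

theorem exists_eq_map_inl_append_map_inr {w : List (I₁ ⊕ₗ I₂)} (h : w.Pairwise (· ≤ ·)) :
    ∃ (w₁ : List I₁) (w₂ : List I₂), w = w₁.map Sum.inlₗ ++ w₂.map Sum.inrₗ := by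
  induction w with
  | nil => exact ⟨[], [], rfl⟩
  | cons a w ih =>
    rw [List.pairwise_cons] at h
    obtain ⟨w₁, w₂, rfl⟩ := ih h.2
    match a, h with
    | Sum.inlₗ a, _ => exact ⟨a :: w₁, w₂, rfl⟩
    | Sum.inrₗ a, h =>
      cases w₁ with
      | nil => exact ⟨[], a :: w₂, rfl⟩
      | cons c w₁ =>
        exact absurd (h.1 (Sum.inlₗ c) (by simp)) (Sum.Lex.not_inr_le_inl)

/-- A sorted word over a lexicographic sum is a sorted word of letters of the first kind, followed
by a sorted word of letters of the second kind. -/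
noncomputable def sortedSumEquiv :
    {w : List I₁ // w.Pairwise (· ≤ ·)} × {w : List I₂ // w.Pairwise (· ≤ ·)} ≃
      {w : List (I₁ ⊕ₗ I₂) // w.Pairwise (· ≤ ·)} :=
  Equiv.ofBijective
    (fun p => ⟨p.1.1.map Sum.inlₗ ++ p.2.1.map Sum.inrₗ,
      pairwise_map_inl_append_map_inr.2 ⟨p.1.2, p.2.2⟩⟩) <| by
    constructor
    · rintro ⟨⟨u, hu⟩, ⟨v, hv⟩⟩ ⟨⟨u', hu'⟩, ⟨v', hv'⟩⟩ h
      have h : u.map Sum.inlₗ ++ v.map Sum.inrₗ = (u'.map Sum.inlₗ ++ v'.map Sum.inrₗ :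
        List (I₁ ⊕ₗ I₂)) := congrArg Subtype.val h
      have h₁ := congrArg (List.filterMap fun x => (ofLex x).getLeft?) h
      have h₂ := congrArg (List.filterMap fun x => (ofLex x).getRight?) h
      simp only [List.filterMap_append, List.filterMap_map] at h₁ h₂
      have e₁ : (fun x : I₁ ⊕ₗ I₂ => (ofLex x).getLeft?) ∘ Sum.inlₗ = some := rfl
      have e₂ : (fun x : I₁ ⊕ₗ I₂ => (ofLex x).getLeft?) ∘ Sum.inrₗ = fun _ => none := rfl
      have e₃ : (fun x : I₁ ⊕ₗ I₂ => (ofLex x).getRight?) ∘ Sum.inlₗ = fun _ => none := rfl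
      have e₄ : (fun x : I₁ ⊕ₗ I₂ => (ofLex x).getRight?) ∘ Sum.inrₗ = some := rfl
      rw [e₁, e₂] at h₁
      rw [e₃, e₄] at h₂
      simp at h₁ h₂
      simp [h₁, h₂]
    · rintro ⟨w, hw⟩
      obtain ⟨w₁, w₂, rfl⟩ := exists_eq_map_inl_append_map_inr hw
      have := pairwise_map_inl_append_map_inr.1 hw
      exact ⟨⟨⟨w₁, this.1⟩, ⟨w₂, this.2⟩⟩, rfl⟩

variable {k : Type*} [Field k] {L : Type*} [LieRing L] [LieAlgebra k L]
  (b : Basis (I₁ ⊕ₗ I₂) k L)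

/-- The Poincaré–Birkhoff–Witt basis for a basis in two blocks. -/
noncomputable def blockBasis :
    Basis ({w : List I₁ // w.Pairwise (· ≤ ·)} × {w : List I₂ // w.Pairwise (· ≤ ·)}) k
      (UniversalEnvelopingAlgebra k L) :=
  (basis b).reindex sortedSumEquiv.symm

theorem blockBasis_apply
    (p : {w : List I₁ // w.Pairwise (· ≤ ·)} × {w : List I₂ // w.Pairwise (· ≤ ·)}) :
    blockBasis b p = monomial b (p.1.1.map Sum.inlₗ) * monomial b (p.2.1.map Sum.inrₗ) := by
  rw [blockBasis, Basis.reindex_apply, basis_apply, Equiv.symm_symm, ← monomial_append]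
  rfl

end Block

variable {k : Type uk} [Field k] {H : Type uM} {L : Type uL} [LieRing H] [LieAlgebra k H]
  [LieRing L] [LieAlgebra k L]

/-- The homomorphism of universal enveloping algebras induced by a homomorphism of Lie algebras. -/
noncomputable def envelopingMap (f : H →ₗ⁅k⁆ L) :
    UniversalEnvelopingAlgebra k H →ₐ[k] UniversalEnvelopingAlgebra k L :=
  lift k ((ι k).comp f)

theorem envelopingMap_ι (f : H →ₗ⁅k⁆ L) (x : H) : envelopingMap f (ι k x) = ι k (f x) :=
  lift_ι_apply _ _ _

theorem envelopingMap_monomial (f : H →ₗ⁅k⁆ L) {I J : Type*} (b : Basis I k H) (c : Basis J k L)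
    (g : I → J) (h : ∀ i, c (g i) = f (b i)) (w : List I) :
    envelopingMap f (monomial b w) = monomial c (w.map g) := by
  simp only [monomial, map_list_prod, List.map_map]
  congr 1
  refine List.map_congr_left fun i _ => ?_
  simp [envelopingMap_ι, h, -ι_apply]

theorem exists_basis_extension (f : H →ₗ⁅k⁆ L) (hf : Function.Injective f) :
    ∃ (I : Type uM) (J : Type uL) (b : Basis I k H) (c : Basis (I ⊕ J) k L),
      ∀ i, c (Sum.inl i) = f (b i) := by
  obtain ⟨C, hC⟩ := Submodule.exists_isCompl (LinearMap.range (f : H →ₗ[k] L))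
  let e := LinearEquiv.ofInjective (f : H →ₗ[k] L) hf
  refine ⟨_, _, Basis.ofVectorSpace k H,
    (((Basis.ofVectorSpace k H).map e).prod (Basis.ofVectorSpace k C)).map
      (Submodule.prodEquivOfIsCompl _ _ hC), fun i => ?_⟩
  simp [e]

/-- A basis of the image of `H` is extended to `L` and its letters are placed first. A sorted word
then splits uniquely into a sorted word of `H` followed by a sorted word in the remaining letters,
and the latter words give the left basis. With the letters of `H` placed last the same argument
gives right freeness. -/
theorem isLeftFreeAlong_envelopingMap (f : H →ₗ⁅k⁆ L) (hf : Function.Injective f) :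
    IsLeftFreeAlong.{uL} (envelopingMap f) := by
  obtain ⟨I, J, b, c, h⟩ := exists_basis_extension f hf
  classical
  let : LinearOrder I := linearOrderOfSTO WellOrderingRel
  let : LinearOrder J := linearOrderOfSTO WellOrderingRel
  let c' : Basis (I ⊕ₗ J) k L := c.reindex toLex
  refine ⟨{w : List J // w.Pairwise (· ≤ ·)}, fun w => monomial c' (w.1.map Sum.inrₗ), ?_⟩
  let B := (Finsupp.basis fun _ : {w : List J // w.Pairwise (· ≤ ·)} => basis b)
  let e := B.equiv (blockBasis c') ((Equiv.sigmaEquivProd _ _).trans (Equiv.prodComm _ _))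
  let Φ : ({w : List J // w.Pairwise (· ≤ ·)} →₀ UniversalEnvelopingAlgebra k H) →ₗ[k]
      UniversalEnvelopingAlgebra k L :=
    Finsupp.lsum k fun w => LinearMap.mulRight k (monomial c' (w.1.map Sum.inrₗ)) ∘ₗ
      (envelopingMap f).toLinearMap
  have hΦ : Φ = e.toLinearMap := by
    refine B.ext fun ⟨v, w⟩ => ?_
    simp only [LinearEquiv.coe_coe, e, Basis.equiv_apply]
    simp [B, Φ, blockBasis_apply, basis_apply,
      envelopingMap_monomial f b c' Sum.inlₗ (fun i => by simpa [c'] using h i)]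
  exact (show Function.Bijective Φ by rw [hΦ]; exact e.bijective)

theorem isRightFreeAlong_envelopingMap (f : H →ₗ⁅k⁆ L) (hf : Function.Injective f) :
    IsRightFreeAlong.{uL} (envelopingMap f) := by
  obtain ⟨I, J, b, c, h⟩ := exists_basis_extension f hf
  classical
  let : LinearOrder I := linearOrderOfSTO WellOrderingRel
  let : LinearOrder J := linearOrderOfSTO WellOrderingRel
  let c' : Basis (J ⊕ₗ I) k L := c.reindex ((Equiv.sumComm I J).trans toLex)
  refine ⟨{w : List J // w.Pairwise (· ≤ ·)}, fun w => monomial c' (w.1.map Sum.inlₗ), ?_⟩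
  let B := (Finsupp.basis fun _ : {w : List J // w.Pairwise (· ≤ ·)} => basis b)
  let e := B.equiv (blockBasis c') (Equiv.sigmaEquivProd _ _)
  let Φ : ({w : List J // w.Pairwise (· ≤ ·)} →₀ UniversalEnvelopingAlgebra k H) →ₗ[k]
      UniversalEnvelopingAlgebra k L :=
    Finsupp.lsum k fun w => LinearMap.mulLeft k (monomial c' (w.1.map Sum.inlₗ)) ∘ₗ
      (envelopingMap f).toLinearMap
  have hΦ : Φ = e.toLinearMap := by
    refine B.ext fun ⟨v, w⟩ => ?_
    simp only [LinearEquiv.coe_coe, e, Basis.equiv_apply]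
    simp [B, Φ, blockBasis_apply, basis_apply,
      envelopingMap_monomial f b c' Sum.inrₗ (fun i => by simpa [c'] using h i)]
  exact (show Function.Bijective Φ by rw [hΦ]; exact e.bijective)

theorem ι_injective : Function.Injective (ι k : L → UniversalEnvelopingAlgebra k L) := by
  let b := Basis.ofVectorSpace k L
  classical
  let : LinearOrder (Basis.ofVectorSpaceIndex k L) := linearOrderOfSTO WellOrderingRel
  have h : LinearIndependent k ((ι k : L →ₗ⁅k⁆ UniversalEnvelopingAlgebra k L).toLinearMap ∘ b) := by
    have := (linearIndependent_monomial b).comp (fun i => ⟨[i], by simp⟩)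
      (fun i j hij => by simpa using hij)
    convert this using 1
    funext i
    simp [monomial, -ι_apply]
  refine (injective_iff_map_eq_zero _).2 fun x hx => ?_
  have h0 := linearIndependent_iff.1 h (b.repr x) (by
    rw [← Finsupp.apply_linearCombination, b.linearCombination_repr]
    exact hx)
  simpa using h0

instance : Nontrivial (UniversalEnvelopingAlgebra k L) := by
  let b := Basis.ofVectorSpace k L
  classical
  let : LinearOrder (Basis.ofVectorSpaceIndex k L) := linearOrderOfSTO WellOrderingRel
  have := (linearIndependent_monomial b).ne_zero ⟨[], by simp⟩
  exact ⟨_, _, this⟩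

end PBW

open TensorProduct MulOpposite

/-! ### Coherence and syzygies -/

section Coherent

variable {S : Type*} [Ring S]

/-- Over a ring whose finitely generated left ideals are finitely presented, the finitely generated
submodules of finite free modules are finitely presented. -/
theorem finitePresentation_of_fg_pi (h : ∀ I : Submodule S S, I.FG → Module.FinitePresentation S I)
    (n : ℕ) (N : Submodule S (Fin n → S)) (hN : N.FG) : Module.FinitePresentation S N := by
  induction n with
  | zero => infer_instance
  | succ n ih =>
    let p : (Fin (n + 1) → S) →ₗ[S] S := LinearMap.proj 0
    let q : (Fin (n + 1) → S) →ₗ[S] (Fin n → S) := LinearMap.funLeft S S Fin.succ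
    have : Module.Finite S N := Module.Finite.iff_fg.2 hN
    have h₁ : Module.FinitePresentation S (N.map p) := h _ (hN.map p)
    -- The first coordinate maps `N` onto a finitely generated, hence finitely presented ideal. So
    -- the kernel is finitely generated, and it embeds in a free module of smaller rank.
    let g : N →ₗ[S] N.map p := p.submoduleMap N
    have hg : Function.Surjective g := p.submoduleMap_surjective N
    have hK : (LinearMap.ker g).FG := Module.FinitePresentation.fg_ker g hg
    let K : Submodule S N := LinearMap.ker g
    let r : K →ₗ[S] (Fin n → S) := q ∘ₗ N.subtype ∘ₗ K.subtype
    have hr : Function.Injective r := by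
      intro x y hxy
      refine Subtype.ext (Subtype.ext (funext fun i => ?_))
      refine Fin.cases ?_ (fun i => ?_) i
      · have hx := congrArg Subtype.val (LinearMap.mem_ker.1 x.2)
        have hy := congrArg Subtype.val (LinearMap.mem_ker.1 y.2)
        exact hx.trans hy.symm
      · exact congrFun hxy i
    have : Module.Finite S K := Module.Finite.iff_fg.2 hK
    have h₂ : Module.FinitePresentation S (LinearMap.range r) :=
      ih _ (Module.Finite.iff_fg.1 inferInstance)
    have h₃ : Module.FinitePresentation S K :=
      Module.FinitePresentation.of_equiv (M := LinearMap.range r) (N := K)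
        (LinearEquiv.ofInjective r hr).symm
    exact Module.finitePresentation_of_ker g hg

/-- The images of finitely many basis vectors involve finitely many coordinates only, so the range
lies in a free module of finite rank and is finitely presented. -/
theorem fg_ker_of_finsupp (h : ∀ I : Submodule S S, I.FG → Module.FinitePresentation S I)
    {n : ℕ} {ι : Type*} (g : (Fin n → S) →ₗ[S] (ι →₀ S)) : (LinearMap.ker g).FG := by
  classical
  let s : Finset ι := Finset.univ.biUnion fun i => (g (Pi.single i 1)).support
  let e : s ≃ Fin s.card := s.equivFin
  let r : (ι →₀ S) →ₗ[S] (Fin s.card → S) :=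
    { toFun := fun f i => f (e.symm i)
      map_add' := fun _ _ => rfl
      map_smul' := fun _ _ => rfl }
  have hs (x) : (g x).support ⊆ s := by
    intro b hb
    by_contra hbs
    have : g x b = 0 := by
      rw [pi_eq_sum_univ' x, map_sum, Finsupp.finsetSum_apply]
      refine Finset.sum_eq_zero fun i _ => ?_
      have : g (Pi.single i 1) b = 0 := by
        by_contra hne
        exact hbs (Finset.mem_biUnion.2 ⟨i, Finset.mem_univ _, Finsupp.mem_support_iff.2 hne⟩)
      rw [map_smul, Finsupp.smul_apply, this, smul_zero]
    exact Finsupp.mem_support_iff.1 hb this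
  have hk : LinearMap.ker g = LinearMap.ker (r ∘ₗ g) := by
    ext x
    refine ⟨fun hx => by simp [LinearMap.mem_ker.1 hx], fun hx => ?_⟩
    refine LinearMap.mem_ker.2 (Finsupp.ext fun b => ?_)
    by_cases hb : b ∈ s
    · have h0 : g x (e.symm (e ⟨b, hb⟩)) = 0 := congrFun (LinearMap.mem_ker.1 hx) (e ⟨b, hb⟩)
      simpa using h0
    · exact Finsupp.notMem_support_iff.1 fun hb' => hb (hs x hb')
  rw [hk]
  have h₁ : Module.FinitePresentation S (LinearMap.range (r ∘ₗ g)) :=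
    finitePresentation_of_fg_pi h _ _ (Module.Finite.iff_fg.1 inferInstance)
  have := Module.FinitePresentation.fg_ker (r ∘ₗ g).rangeRestrict
    (LinearMap.surjective_rangeRestrict _)
  rwa [LinearMap.ker_rangeRestrict] at this

end Coherent

/-! ### Balanced tensors -/

section Balanced

variable {k : Type*} [Field k] {R : Type*} [Ring R] [Algebra k R]

/-- The kernel of `M ⊗[k] X → M ⊗[A] X` for a right module `M`, a left module `X` and the
subalgebra `A` generated by `S`. -/
def balancedSubmodule (k : Type*) [Field k] {R : Type*} [Ring R] [Algebra k R] (S : Set R)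
    (M X : Type*) [AddCommGroup M] [Module k M] [Module Rᵐᵒᵖ M] [AddCommGroup X] [Module k X]
    [Module R X] : Submodule k (M ⊗[k] X) :=
  Submodule.span k {t | ∃ s ∈ S, ∃ (m : M) (x : X), t = (op s • m) ⊗ₜ x - m ⊗ₜ (s • x)}

variable {M M' X X' : Type*} [AddCommGroup M] [Module k M] [Module Rᵐᵒᵖ M] [AddCommGroup M']
  [Module k M'] [Module Rᵐᵒᵖ M'] [AddCommGroup X] [Module k X] [Module R X] [AddCommGroup X']
  [Module k X'] [Module R X'] [IsScalarTower k Rᵐᵒᵖ M] [IsScalarTower k R X]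

omit [IsScalarTower k Rᵐᵒᵖ M] [IsScalarTower k R X] in
theorem balanced_tmul {S : Set R} {s : R} (hs : s ∈ S) (m : M) (x : X) :
    (op s • m) ⊗ₜ x - m ⊗ₜ (s • x) ∈ balancedSubmodule k S M X :=
  Submodule.subset_span ⟨s, hs, m, x, rfl⟩

omit [IsScalarTower k Rᵐᵒᵖ M] [IsScalarTower k R X] in
theorem balancedSubmodule_mono {S S' : Set R} (h : S ⊆ S') :
    balancedSubmodule k S M X ≤ balancedSubmodule k S' M X :=
  Submodule.span_mono fun _ ⟨s, hs, m, x, e⟩ => ⟨s, h hs, m, x, e⟩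

omit [IsScalarTower k Rᵐᵒᵖ M] [IsScalarTower k R X] in
theorem balancedSubmodule_le_iff {S : Set R} {P : Submodule k (M ⊗[k] X)} :
    balancedSubmodule k S M X ≤ P ↔
      ∀ s ∈ S, ∀ (m : M) (x : X), (op s • m) ⊗ₜ x - m ⊗ₜ (s • x) ∈ P := by
  refine ⟨fun h s hs m x => h (balanced_tmul hs m x), fun h => Submodule.span_le.2 ?_⟩
  rintro _ ⟨s, hs, m, x, rfl⟩
  exact h s hs m x

/-- The elements over which a given submodule is balanced are closed under sums and products, so a
subalgebra may be replaced by a set of generators. -/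
theorem balancedSubmodule_adjoin (S : Set R) :
    balancedSubmodule k (Algebra.adjoin k S : Set R) M X = balancedSubmodule k S M X := by
  refine le_antisymm (balancedSubmodule_le_iff.2 fun s hs => ?_)
    (balancedSubmodule_mono Algebra.subset_adjoin)
  induction hs using Algebra.adjoin_induction with
  | mem s hs => exact fun m x => balanced_tmul hs m x
  | algebraMap c =>
    intro m x
    have : (op (algebraMap k R c) • m) ⊗ₜ[k] x - m ⊗ₜ (algebraMap k R c • x) = 0 := by
      rw [← MulOpposite.algebraMap_apply, algebraMap_smul, algebraMap_smul, smul_tmul, sub_self]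
    rw [this]
    exact Submodule.zero_mem _
  | add s s' _ _ hs hs' =>
    intro m x
    have := Submodule.add_mem _ (hs m x) (hs' m x)
    rw [op_add, add_smul, add_smul, add_tmul, tmul_add]
    convert this using 1
    abel
  | mul s s' _ _ hs hs' =>
    intro m x
    have := Submodule.add_mem _ (hs' (op s • m) x) (hs m (s' • x))
    rw [op_mul, mul_smul, mul_smul]
    convert this using 1
    abel

omit [IsScalarTower k Rᵐᵒᵖ M] [IsScalarTower k R X] in
theorem map_balancedSubmodule_le (S : Set R) (f : M →ₗ[k] M') (g : X →ₗ[k] X')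
    (hf : ∀ s ∈ S, ∀ m, f (op s • m) = op s • f m) (hg : ∀ s ∈ S, ∀ x, g (s • x) = s • g x) :
    balancedSubmodule k S M X ≤ (balancedSubmodule k S M' X').comap (TensorProduct.map f g) := by
  refine balancedSubmodule_le_iff.2 fun s hs m x => ?_
  simpa [hf s hs, hg s hs] using balanced_tmul hs (f m) (g x)

omit [IsScalarTower k Rᵐᵒᵖ M] [IsScalarTower k R X] in
/-- A balanced tensor lifts along a surjection to a balanced tensor. -/
theorem exists_balanced_lift (S : Set R) (f : M →ₗ[k] M') (hf' : Function.Surjective f)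
    (hf : ∀ s ∈ S, ∀ m, f (op s • m) = op s • f m) {t : M' ⊗[k] X}
    (ht : t ∈ balancedSubmodule k S M' X) :
    ∃ t' ∈ balancedSubmodule k S M X, f.rTensor X t' = t := by
  suffices h : balancedSubmodule k S M' X ≤ (balancedSubmodule k S M X).map (f.rTensor X) from
    h ht
  refine balancedSubmodule_le_iff.2 fun s hs m x => ?_
  obtain ⟨m, rfl⟩ := hf' m
  exact ⟨_, balanced_tmul hs m x, by simp [hf s hs]⟩

/-- The component of a tensor with coefficients in a power of `R`. -/
noncomputable def component (k : Type*) [Field k] (R : Type*) [Ring R] [Algebra k R] (M : Type*)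
    [AddCommGroup M] [Module k M] {J : Type*} (j : J) :
    M ⊗[k] (J → R) →ₗ[k] M ⊗[k] R :=
  (LinearMap.proj j : (J → R) →ₗ[k] R).lTensor M

theorem component_tmul {M : Type*} [AddCommGroup M] [Module k M] {J : Type*} (j : J) (m : M)
    (x : J → R) : component k R M j (m ⊗ₜ x) = m ⊗ₜ x j := by
  simp [component]

omit [IsScalarTower k Rᵐᵒᵖ M] in
theorem component_mem_balanced {S : Set R} {J : Type*} (j : J) {t : M ⊗[k] (J → R)}
    (ht : t ∈ balancedSubmodule k S M (J → R)) :
    component k R M j t ∈ balancedSubmodule k S M R := by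
  have h := map_balancedSubmodule_le (k := k) (X := J → R) (X' := R) S (LinearMap.id : M →ₗ[k] M)
    (LinearMap.proj j : (J → R) →ₗ[k] R) (fun _ _ _ => rfl) (fun _ _ _ => rfl)
  exact h ht

end Balanced

/-! ### Linear relations and the vanishing of balanced tensors. -/

section Syzygies

variable {k : Type*} [Field k] {A R : Type*} [Ring A] [Ring R] [Algebra k A] [Algebra k R]

/-- A ring as a right module over itself is its opposite ring as a left module over itself. -/
def opRegularEquiv (A : Type*) [Ring A] : A ≃ₗ[Aᵐᵒᵖ] Aᵐᵒᵖ :=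
  { opAddEquiv with map_smul' := fun _ _ => rfl }

/-- The linear relations over `A` between the elements `m i` of a right module over `R`. -/
def syzygies (f : A →ₐ[k] R) {M : Type*} [AddCommGroup M] [Module Rᵐᵒᵖ M] {n : ℕ}
    (m : Fin n → M) : Submodule Aᵐᵒᵖ (Fin n → Aᵐᵒᵖ) where
  carrier := {c | ∑ i, op (f (unop (c i))) • m i = 0}
  zero_mem' := by simp
  add_mem' {c d} hc hd := by
    have hc : ∑ i, op (f (unop (c i))) • m i = 0 := hc
    have hd : ∑ i, op (f (unop (d i))) • m i = 0 := hd
    simp [add_smul, Finset.sum_add_distrib, hc, hd]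
  smul_mem' a c hc := by
    have hc : ∑ i, op (f (unop (c i))) • m i = 0 := hc
    simp [mul_smul, ← Finset.smul_sum, hc]

theorem mem_syzygies {f : A →ₐ[k] R} {M : Type*} [AddCommGroup M] [Module Rᵐᵒᵖ M] {n : ℕ}
    {m : Fin n → M} {c : Fin n → Aᵐᵒᵖ} :
    c ∈ syzygies f m ↔ ∑ i, op (f (unop (c i))) • m i = 0 := Iff.rfl

theorem IsRightNoetherianRing.fg_syzygies (hA : IsRightNoetherianRing A) (f : A →ₐ[k] R)
    {M : Type*} [AddCommGroup M] [Module Rᵐᵒᵖ M] {n : ℕ} (m : Fin n → M) :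
    (syzygies f m).FG := by
  have : IsNoetherian Aᵐᵒᵖ A := hA
  have : IsNoetherian Aᵐᵒᵖ Aᵐᵒᵖ := isNoetherian_of_linearEquiv (opRegularEquiv A)
  exact IsNoetherian.noetherian _

theorem IsRightCoherentRing.finitePresentation (hA : IsRightCoherentRing A)
    (I : Submodule Aᵐᵒᵖ Aᵐᵒᵖ) (hI : I.FG) : Module.FinitePresentation Aᵐᵒᵖ I := by
  have := hA (I.map (opRegularEquiv A).symm.toLinearMap) (hI.map _)
  exact Module.FinitePresentation.of_equiv ((opRegularEquiv A).symm.submoduleMap I).symm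

/-- Right freeness identifies `R` with a free right `A`-module, so the relations are the kernel of a
map from a finite free module to a free module. -/
theorem IsRightCoherentRing.fg_syzygies (hA : IsRightCoherentRing A) {f : A →ₐ[k] R}
    (hf : IsRightFreeAlong f) {n : ℕ} (a : Fin n → R) : (syzygies f a).FG := by
  obtain ⟨ι, b, hb⟩ := hf
  let Φ : (ι →₀ Aᵐᵒᵖ) →+ R := Finsupp.liftAddHom fun i =>
    (AddMonoidHom.mulLeft (b i)).comp ((f : A →+ R).comp (opAddEquiv (α := A)).symm.toAddMonoidHom)
  have hΦ (v : ι →₀ Aᵐᵒᵖ) : Φ v =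
      (v.mapRange unop (by simp)).sum fun i a => b i * f a := by
    rw [Finsupp.sum_mapRange_index (by simp)]
    rfl
  have hsmul (c : Aᵐᵒᵖ) (v) : Φ (c • v) = Φ v * f (unop c) := by
    induction v using Finsupp.induction_linear with
    | zero => simp
    | add v w hv hw => rw [smul_add, map_add, hv, hw, map_add, add_mul]
    | single i a =>
      rw [Finsupp.smul_single, Finsupp.liftAddHom_apply_single, Finsupp.liftAddHom_apply_single]
      simp [mul_assoc]
  have hinj : Function.Injective Φ := by
    intro v w h
    rw [hΦ, hΦ] at h
    have := hb.1 h
    ext i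
    simpa using DFunLike.congr_fun this i
  have hsurj : Function.Surjective Φ := by
    intro r
    obtain ⟨v, hv⟩ := hb.2 r
    refine ⟨v.mapRange op (by simp), ?_⟩
    rw [hΦ, ← hv]
    congr 1
    ext i
    simp
  choose v hv using fun i => hsurj (a i)
  let g : (Fin n → Aᵐᵒᵖ) →ₗ[Aᵐᵒᵖ] (ι →₀ Aᵐᵒᵖ) := Fintype.linearCombination Aᵐᵒᵖ v
  have hg (c) : Φ (g c) = ∑ i, op (f (unop (c i))) • a i := by
    simp [g, Fintype.linearCombination_apply, hsmul, hv]
  have : syzygies f a = LinearMap.ker g := by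
    ext c
    rw [mem_syzygies, ← hg, LinearMap.mem_ker]
    exact ⟨fun h => hinj (h.trans (map_zero Φ).symm), fun h => by rw [h, map_zero]⟩
  rw [this]
  exact fg_ker_of_finsupp hA.finitePresentation g

/-- A linear relation with coefficients in a free left module is a consequence of linear relations
over the base ring. -/
theorem IsLeftFreeAlong.exists_syzygies {f : A →ₐ[k] R} (hf : IsLeftFreeAlong f) {M : Type*}
    [AddCommGroup M] [Module k M] [Module Rᵐᵒᵖ M] [IsScalarTower k Rᵐᵒᵖ M] {n : ℕ} (m : Fin n → M)
    (hm : (syzygies f m).FG) {J : Type*} (x : Fin n → J → R)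
    (h : ∀ j, ∑ i, m i ⊗ₜ x i j ∈ balancedSubmodule k (Set.range f) M R) :
    ∃ (p : ℕ) (c : Fin p → Fin n → A) (y : Fin p → J → R),
      (∀ l, ∑ i, op (f (c l i)) • m i = 0) ∧ ∀ i, x i = ∑ l, f (c l i) • y l := by
  classical
  obtain ⟨ι, b, hb⟩ := hf
  let Φ : (ι →₀ A) →ₗ[k] R :=
    Finsupp.lsum k fun i => LinearMap.mulRight k (b i) ∘ₗ f.toLinearMap
  let e : (ι →₀ A) ≃ₗ[k] R := LinearEquiv.ofBijective Φ hb
  have he (v) : e v = v.sum fun i a => f a * b i := rfl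
  have hsmul (a : A) (v) : e (a • v) = f a * e v := by
    induction v using Finsupp.induction_linear with
    | zero => simp
    | add v w hv hw => rw [smul_add, map_add, hv, hw, map_add, mul_add]
    | single i a =>
      rw [Finsupp.smul_single, he, he, Finsupp.sum_single_index (by simp),
        Finsupp.sum_single_index (by simp), smul_eq_mul, map_mul, mul_assoc]
  have hsymm (a : A) (r) : e.symm (f a * r) = a • e.symm r := by
    rw [LinearEquiv.symm_apply_eq, hsmul, LinearEquiv.apply_symm_apply]
  -- `κ β` sends `m ⊗ r` to `m` times the coordinate of `r` at `β` in the left basis. It kills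
  -- balanced tensors, so the coordinates of the `x i j` at `β` form a syzygy of the `m i`.
  let κ (β : ι) : M ⊗[k] R →ₗ[k] M := TensorProduct.lift <|
    LinearMap.mk₂ k (fun m r => op (f (e.symm r β)) • m)
      (fun _ _ _ => smul_add _ _ _)
      (fun c m r => smul_comm _ _ _)
      (fun m r s => by simp [add_smul])
      (fun c m r => by simp)
  have hκ (β) (m : M) (r : R) : κ β (m ⊗ₜ r) = op (f (e.symm r β)) • m := rfl
  have hκb (β) : balancedSubmodule k (Set.range f) M R ≤ LinearMap.ker (κ β) := by
    refine balancedSubmodule_le_iff.2 ?_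
    rintro _ ⟨a, rfl⟩ m r
    rw [LinearMap.mem_ker, map_sub, hκ, hκ, smul_eq_mul, hsymm]
    simp [mul_smul]
  obtain ⟨p, c, hc⟩ := Submodule.fg_iff_exists_fin_generating_family.1 hm
  have hN (j β) : (fun i => op (e.symm (x i j) β)) ∈ syzygies f m := by
    have := LinearMap.mem_ker.1 (hκb β (h j))
    simpa [hκ, mem_syzygies] using this
  -- The generators `c l` serve all `j` and `β` at once; this uniformity allows `J` to be infinite.
  have hu (j β) : ∃ u : Fin p → Aᵐᵒᵖ, ∑ l, u l • c l = fun i => op (e.symm (x i j) β) := by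
    have := hN j β
    rw [← hc] at this
    exact (Submodule.mem_span_range_iff_exists_fun _).1 this
  choose u hu using hu
  let s (j : J) : Finset ι := Finset.univ.biUnion fun i => (e.symm (x i j)).support
  refine ⟨p, fun l i => unop (c l i), fun l j => ∑ β ∈ s j, f (unop (u j β l)) * b β,
    fun l => ?_, fun i => funext fun j => ?_⟩
  · exact mem_syzygies.1 (hc ▸ Submodule.subset_span ⟨l, rfl⟩)
  · have h₁ : x i j = ∑ β ∈ s j, f (e.symm (x i j) β) * b β := by
      conv_lhs => rw [← e.apply_symm_apply (x i j), he]
      refine Finsupp.sum_of_support_subset _ ?_ _ (by simp)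
      exact Finset.subset_biUnion_of_mem (fun i => (e.symm (x i j)).support) (Finset.mem_univ i)
    have h₂ (β) : e.symm (x i j) β = ∑ l, unop (c l i) * unop (u j β l) := by
      have := congrArg unop (congrFun (hu j β) i)
      simpa using this.symm
    rw [h₁]
    simp only [h₂, map_sum, map_mul, Finset.sum_mul, Finset.sum_apply, Pi.smul_apply, smul_eq_mul,
      Finset.mul_sum, mul_assoc]
    rw [Finset.sum_comm]

/-- Coefficients from `S` may be moved across the tensor sign, where the relations annihilate each
`y l`. This is the converse direction to `IsLeftFreeAlong.exists_syzygies`. -/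
theorem sum_tmul_mem_balanced {S : Set R} {M X : Type*}
    [AddCommGroup M] [Module k M] [Module Rᵐᵒᵖ M] [AddCommGroup X] [Module k X] [Module R X]
    {n p : ℕ} {m : Fin n → M} {x : Fin n → X} {c : Fin p → Fin n → R} {y : Fin p → X}
    (hS : ∀ l i, c l i ∈ S) (hc : ∀ l, ∑ i, op (c l i) • m i = 0)
    (hx : ∀ i, x i = ∑ l, c l i • y l) : ∑ i, m i ⊗ₜ x i ∈ balancedSubmodule k S M X := by
  have h : ∑ l, ∑ i, ((op (c l i) • m i) ⊗ₜ[k] y l - m i ⊗ₜ[k] (c l i • y l)) ∈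
      balancedSubmodule k S M X :=
    Submodule.sum_mem _ fun l _ => Submodule.sum_mem _ fun i _ => balanced_tmul (hS l i) _ _
  simp only [Finset.sum_sub_distrib, ← sum_tmul, hc, zero_tmul,
    zero_sub] at h
  rw [Finset.sum_neg_distrib, Submodule.neg_mem_iff, Finset.sum_comm] at h
  simpa only [hx, tmul_sum] using h

theorem exists_eq_sum_fin_tmul {M X : Type*} [AddCommGroup M] [Module k M] [AddCommGroup X]
    [Module k X] (t : M ⊗[k] X) : ∃ (n : ℕ) (m : Fin n → M) (x : Fin n → X),
      t = ∑ i, m i ⊗ₜ x i := by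
  obtain ⟨n, m, x, h⟩ := TensorProduct.exists_sum_tmul_eq t
  exact ⟨n, m, x, h⟩

end Syzygies

/-! ### Chase's criterion for right coherence. -/

section Predicates

variable {k : Type uk} [Field k] {R : Type uL} [Ring R] [Algebra k R]

/-- A tensor with coefficients in a power of `R` is balanced over `S` if its components are. -/
def BalancedComponentwise (k : Type uk) [Field k] {R : Type uL} [Ring R] [Algebra k R]
    (S : Set R) : Prop :=
  ∀ (M : Type uL) [AddCommGroup M] [Module k M] [Module Rᵐᵒᵖ M] [IsScalarTower k Rᵐᵒᵖ M]
    (J : Type uL) (t : M ⊗[k] (J → R)),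
    (∀ j, component k R M j t ∈ balancedSubmodule k S M R) →
      t ∈ balancedSubmodule k S M (J → R)

/-- The inclusion of a right ideal into `R`, as a linear map over the base field. -/
def idealInclusion (k : Type uk) [Field k] {R : Type uL} [Ring R] [Algebra k R]
    (I : Submodule Rᵐᵒᵖ R) : I →ₗ[k] R :=
  I.subtype.restrictScalars k

/-- Tensors with coefficients in an ideal and in a power of `R` are balanced over `S` if they are
balanced as tensors with coefficients in `R`. -/
def BalancedReflecting (k : Type uk) [Field k] {R : Type uL} [Ring R] [Algebra k R]
    (S : Set R) : Prop :=
  ∀ (I : Submodule Rᵐᵒᵖ R) (J : Type uL) (t : I ⊗[k] (J → R)),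
    (idealInclusion k I).rTensor (J → R) t ∈ balancedSubmodule k S R (J → R) →
      t ∈ balancedSubmodule k S I (J → R)

theorem IsRightNoetherianRing.balancedComponentwise {A : Type*} [Ring A] [Algebra k A]
    (hA : IsRightNoetherianRing A) {f : A →ₐ[k] R} (hf : IsLeftFreeAlong f) :
    BalancedComponentwise k (Set.range f) := by
  intro M _ _ _ _ J t ht
  obtain ⟨n, m, x, rfl⟩ := exists_eq_sum_fin_tmul t
  obtain ⟨p, c, y, hc, hx⟩ := hf.exists_syzygies m (hA.fg_syzygies f m) x
    (fun j => by simpa [component_tmul] using ht j)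
  exact sum_tmul_mem_balanced (fun l i => ⟨c l i, rfl⟩) hc hx

/-- Relations between elements of `I` are the same in `I` as in `R`. There they are finitely
generated, so the equations that make the tensor vanish over `R` already hold over `I`. -/
theorem IsRightCoherentRing.balancedReflecting {A : Type*} [Ring A] [Algebra k A]
    (hA : IsRightCoherentRing A) {f : A →ₐ[k] R} (hf : IsLeftFreeAlong f)
    (hf' : IsRightFreeAlong f) : BalancedReflecting k (Set.range f) := by
  intro I J t ht
  obtain ⟨n, m, x, rfl⟩ := exists_eq_sum_fin_tmul t
  obtain ⟨p, c, y, hc, hx⟩ := hf.exists_syzygies (fun i => (m i : R))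
    (hA.fg_syzygies hf' fun i => (m i : R)) x (fun j => by
      have := component_mem_balanced j ht
      simpa [component_tmul, idealInclusion] using this)
  refine sum_tmul_mem_balanced (fun l i => ⟨c l i, rfl⟩) (fun l => Subtype.ext ?_) hx
  simpa using hc l

/-- A criterion for right coherence. -/
theorem BalancedReflecting.isRightCoherentRing (h : BalancedReflecting k (Set.univ : Set R)) :
    IsRightCoherentRing R := by
  intro I hI
  obtain ⟨n, a, ha⟩ := Submodule.fg_iff_exists_fin_generating_family.1 hI
  have haI (i) : a i ∈ I := ha ▸ Submodule.subset_span ⟨i, rfl⟩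
  let l : (Fin n → Rᵐᵒᵖ) →ₗ[Rᵐᵒᵖ] I := Fintype.linearCombination Rᵐᵒᵖ fun i => ⟨a i, haI i⟩
  have hl_apply (c) : (l c : R) = ∑ i, c i • a i := by simp [l, Fintype.linearCombination_apply]
  have hl : Function.Surjective l := by
    rintro ⟨r, hr⟩
    rw [← ha] at hr
    obtain ⟨c, hc⟩ := (Submodule.mem_span_range_iff_exists_fun _).1 hr
    exact ⟨c, Subtype.ext ((hl_apply c).trans hc)⟩
  refine Module.finitePresentation_of_surjective l hl ?_
  set N := LinearMap.ker l with hN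
  -- The power of `R` is indexed by the relation module `N` itself, and `x i` is the `i`-th
  -- coordinate. Then `∑ a i • x i = 0` expresses all relations at once.
  let x (i : Fin n) : N → R := fun c => unop (c.1 i)
  let act : (Fin n → Rᵐᵒᵖ) →ₗ[k] (N → R) →ₗ[k] (Fin n → N → R) :=
    LinearMap.mk₂ k (fun c y i => unop (c i) • y) (fun _ _ _ => funext fun _ => add_smul _ _ _)
      (fun _ _ _ => funext fun _ => smul_assoc _ _ _)
      (fun _ _ _ => funext fun _ => smul_add _ _ _)
      (fun _ _ _ => funext fun _ => smul_comm _ _ _)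
  let NX : Submodule k (Fin n → N → R) := Submodule.span k {z | ∃ c ∈ N, ∃ y, z = act c y}
  -- The section is linear over the field only; its failure to be `R`-linear lies in `N` and
  -- disappears modulo `NX`.
  obtain ⟨s, hs⟩ := (l.restrictScalars k).exists_rightInverse_of_surjective
    (LinearMap.range_eq_top.2 hl)
  have hs (u : I) : l (s u) = u := DFunLike.congr_fun hs u
  let Θ : I ⊗[k] (N → R) →ₗ[k] (Fin n → N → R) := TensorProduct.lift (act ∘ₗ s)
  have hΘ (u y) : Θ (u ⊗ₜ[k] y) = act (s u) y := rfl
  have hΘb : balancedSubmodule k (Set.univ : Set R) I (N → R) ≤ NX.comap Θ := by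
    refine balancedSubmodule_le_iff.2 fun r _ u y => ?_
    rw [Submodule.mem_comap, map_sub, hΘ, hΘ]
    refine Submodule.subset_span ⟨s (op r • u) - op r • s u, ?_, y, ?_⟩
    · rw [hN, LinearMap.mem_ker, map_sub, hs, l.map_smul, hs, sub_self]
    · rw [map_sub, LinearMap.sub_apply]
      congr 1
      ext i j
      simp [act, mul_assoc]
  have ht : ∑ i, (⟨a i, haI i⟩ : I) ⊗ₜ[k] x i ∈ balancedSubmodule k (Set.univ : Set R) I (N → R) := by
    refine h I N _ ?_
    have h0 : ∑ i, a i • x i = 0 := by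
      ext c
      have := (hl_apply c.1).symm.trans (congrArg Subtype.val (LinearMap.mem_ker.1 c.2))
      simpa [x] using this
    have h1 : ∑ i, ((op (a i) • (1 : R)) ⊗ₜ[k] x i - (1 : R) ⊗ₜ[k] (a i • x i)) ∈
        balancedSubmodule k (Set.univ : Set R) R (N → R) :=
      Submodule.sum_mem _ fun i _ => balanced_tmul (Set.mem_univ _) _ _
    rw [Finset.sum_sub_distrib, ← tmul_sum, h0] at h1
    simpa [idealInclusion] using h1
  have hx : x ∈ NX := by
    have h1 := hΘb ht
    rw [Submodule.mem_comap, map_sum] at h1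
    have h2 : x = ∑ i, act (Pi.single i 1) (x i) := by
      ext i j
      simp [act, Pi.single_apply, Finset.sum_apply, apply_ite unop, ite_apply]
    rw [h2, ← sub_add_cancel (∑ i, act (Pi.single i 1) (x i)) (∑ i, Θ ((⟨a i, haI i⟩ : I) ⊗ₜ x i)),
      ← Finset.sum_sub_distrib]
    refine NX.add_mem (Submodule.sum_mem _ fun i _ => ?_) h1
    refine Submodule.subset_span ⟨Pi.single i 1 - s ⟨a i, haI i⟩, ?_, x i, ?_⟩
    · rw [hN, LinearMap.mem_ker, map_sub, hs, sub_eq_zero]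
      simp [l]
    · rw [map_sub, LinearMap.sub_apply, hΘ]
  -- An element of `NX` involves finitely many relations, and these generate its value at every
  -- index. Applied to the universal tuple `x`, whose value at `c` is `c`, this shows that `N` is
  -- finitely generated.
  have key (z) (hz : z ∈ NX) : ∃ P : Submodule Rᵐᵒᵖ (Fin n → Rᵐᵒᵖ), P.FG ∧ P ≤ N ∧
      ∀ j, (fun i => op (z i j)) ∈ P := by
    induction hz using Submodule.span_induction with
    | mem z hz =>
      obtain ⟨c, hc, y, rfl⟩ := hz
      refine ⟨Submodule.span _ {c}, Submodule.fg_span_singleton c, by simpa using hc, fun j => ?_⟩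
      refine Submodule.mem_span_singleton.2 ⟨op (y j), ?_⟩
      ext i
      simp [act]
    | zero => exact ⟨⊥, Submodule.fg_bot, bot_le, fun j => by simp; rfl⟩
    | add z z' _ _ hz hz' =>
      obtain ⟨P, h₁, h₂, h₃⟩ := hz
      obtain ⟨P', h₁', h₂', h₃'⟩ := hz'
      exact ⟨P ⊔ P', h₁.sup h₁', sup_le h₂ h₂', fun j =>
        Submodule.add_mem_sup (h₃ j) (h₃' j)⟩
    | smul r z _ hz =>
      obtain ⟨P, h₁, h₂, h₃⟩ := hz
      refine ⟨P, h₁, h₂, fun j => ?_⟩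
      have := P.smul_of_tower_mem r (h₃ j)
      exact this
  obtain ⟨P, h₁, h₂, h₃⟩ := key x hx
  rwa [← le_antisymm h₂ fun c hc => h₃ ⟨c, hc⟩]

end Predicates

/-! ### Balancing over unions and over a single element. -/

section Twist

variable {k : Type*} [Field k] {R : Type*} [Ring R] [Algebra k R]
variable {M M' X X' : Type*} [AddCommGroup M] [Module k M] [Module Rᵐᵒᵖ M] [AddCommGroup M']
  [Module k M'] [Module Rᵐᵒᵖ M'] [AddCommGroup X] [Module k X] [Module R X] [AddCommGroup X']
  [Module k X'] [Module R X'] [IsScalarTower k Rᵐᵒᵖ M] [IsScalarTower k R X]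
  [IsScalarTower k Rᵐᵒᵖ M'] [IsScalarTower k R X']

omit [IsScalarTower k Rᵐᵒᵖ M] [IsScalarTower k R X] in
theorem balancedSubmodule_iUnion {V : Sort*} (C : V → Set R) :
    balancedSubmodule k (⋃ v, C v) M X = ⨆ v, balancedSubmodule k (C v) M X := by
  refine le_antisymm (balancedSubmodule_le_iff.2 fun s hs m x => ?_)
    (iSup_le fun v => balancedSubmodule_mono (Set.subset_iUnion C v))
  obtain ⟨v, hv⟩ := Set.mem_iUnion.1 hs
  exact Submodule.mem_iSup_of_mem v (balanced_tmul hv m x)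

omit [IsScalarTower k Rᵐᵒᵖ M] [IsScalarTower k R X] in
theorem balancedSubmodule_union (C C' : Set R) :
    balancedSubmodule k (C ∪ C') M X = balancedSubmodule k C M X ⊔ balancedSubmodule k C' M X := by
  refine le_antisymm (balancedSubmodule_le_iff.2 fun s hs m x => ?_)
    (sup_le (balancedSubmodule_mono Set.subset_union_left)
      (balancedSubmodule_mono Set.subset_union_right))
  rcases hs with hs | hs
  · exact Submodule.mem_sup_left (balanced_tmul hs m x)
  · exact Submodule.mem_sup_right (balanced_tmul hs m x)

/-- The map `m ⊗ x ↦ m r ⊗ x - m ⊗ r x`. -/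
noncomputable def balancingMap (k : Type*) [Field k] {R : Type*} [Ring R] [Algebra k R] (r : R)
    (M X : Type*) [AddCommGroup M] [Module k M] [Module Rᵐᵒᵖ M] [AddCommGroup X] [Module k X]
    [Module R X] [IsScalarTower k Rᵐᵒᵖ M] [IsScalarTower k R X] : M ⊗[k] X →ₗ[k] M ⊗[k] X :=
  (Algebra.lsmul k k M (op r)).rTensor X - (Algebra.lsmul k k X r).lTensor M

theorem balancingMap_tmul (r : R) (m : M) (x : X) :
    balancingMap k r M X (m ⊗ₜ x) = (op r • m) ⊗ₜ x - m ⊗ₜ (r • x) := rfl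

theorem balancedSubmodule_singleton (r : R) :
    balancedSubmodule k {r} M X = LinearMap.range (balancingMap k r M X) := by
  refine le_antisymm (balancedSubmodule_le_iff.2 ?_) ?_
  · rintro _ rfl m x
    exact ⟨m ⊗ₜ x, balancingMap_tmul _ m x⟩
  · rintro _ ⟨t, rfl⟩
    induction t with
    | zero => simp
    | tmul m x => exact balanced_tmul (Set.mem_singleton r) m x
    | add t t' h h' => rw [map_add]; exact Submodule.add_mem _ h h'

theorem map_balancingMap (r : R) (f : M →ₗ[k] M') (g : X →ₗ[k] X')
    (hf : ∀ m, f (op r • m) = op r • f m) (hg : ∀ x, g (r • x) = r • g x) (t : M ⊗[k] X) :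
    TensorProduct.map f g (balancingMap k r M X t) =
      balancingMap k r M' X' (TensorProduct.map f g t) := by
  induction t with
  | zero => simp
  | tmul m x => simp [balancingMap_tmul, hf, hg]
  | add t t' h h' => simp only [map_add, h, h']

theorem component_balancingMap (r : R) {J : Type*} (j : J) (t : M ⊗[k] (J → R)) :
    component k R M j (balancingMap k r M (J → R) t) =
      balancingMap k r M R (component k R M j t) := by
  have h := map_balancingMap (X := J → R) (X' := R) r (LinearMap.id : M →ₗ[k] M)
    (LinearMap.proj j : (J → R) →ₗ[k] R) (fun _ => rfl) (fun _ => rfl) t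
  exact h

/-- Modulo tensors balanced over `A`, which is contained in `C`, moving `a` past `r` leaves only the
commutator of `r` and `a`, and this lies in `C`. -/
theorem balancingMap_mem_of_mem {C A : Set R} {r : R} (hAC : A ⊆ C)
    (hr : ∀ a ∈ A, r * a - a * r ∈ C) {t : M ⊗[k] X} (ht : t ∈ balancedSubmodule k A M X) :
    balancingMap k r M X t ∈ balancedSubmodule k C M X := by
  suffices h : balancedSubmodule k A M X ≤ (balancedSubmodule k C M X).comap
    (balancingMap k r M X) from h ht
  refine balancedSubmodule_le_iff.2 fun a ha m x => ?_
  have h₁ := balanced_tmul (k := k) (hAC ha) (op r • m) x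
  have h₂ := balanced_tmul (k := k) (hAC ha) m (r • x)
  have h₃ := balanced_tmul (k := k) (hr a ha) m x
  have := Submodule.sub_mem _ (Submodule.sub_mem _ h₁ h₂) h₃
  rw [Submodule.mem_comap, map_sub, balancingMap_tmul, balancingMap_tmul]
  convert this using 1
  rw [op_sub, sub_smul, sub_smul, op_mul, op_mul, mul_smul, mul_smul, mul_smul, mul_smul, sub_tmul,
    tmul_sub]
  abel

end Twist

/-! ### The diagram chases for trees and for stable letters. -/

section Chase

variable {k : Type uk} [Field k] {R : Type uL} [Ring R] [Algebra k R]

/-- The projection to the quotient by a right ideal, as a linear map over the base field. -/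
def idealProjection (k : Type uk) [Field k] {R : Type uL} [Ring R] [Algebra k R]
    (I : Submodule Rᵐᵒᵖ R) : R →ₗ[k] R ⧸ I :=
  I.mkQ.restrictScalars k

theorem exact_idealInclusion_rTensor (I : Submodule Rᵐᵒᵖ R) (X : Type*) [AddCommGroup X]
    [Module k X] :
    Function.Exact ((idealInclusion k I).rTensor X) ((idealProjection k I).rTensor X) := by
  refine rTensor_exact X (fun r => ?_) I.mkQ_surjective
  change I.mkQ r = 0 ↔ r ∈ Set.range I.subtype
  simp

/-- A tensor that is balanced modulo `I` lifts to a balanced tensor over `R`, and the error comes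
from `I` by right exactness. -/
theorem BalancedComponentwise.exists_decomposition {A : Set R} (hA : BalancedComponentwise k A)
    (I : Submodule Rᵐᵒᵖ R) {J : Type uL} {z : R ⊗[k] (J → R)}
    (h : ∀ j, component k R (R ⧸ I) j ((idealProjection k I).rTensor (J → R) z) ∈
      balancedSubmodule k A (R ⧸ I) R) :
    ∃ z' ∈ balancedSubmodule k A R (J → R), ∃ s : I ⊗[k] (J → R),
      z = z' + (idealInclusion k I).rTensor (J → R) s := by
  obtain ⟨z', hz', he⟩ := exists_balanced_lift A (idealProjection k I) I.mkQ_surjective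
    (fun _ _ _ => rfl) (hA (R ⧸ I) J _ h)
  obtain ⟨s, hs⟩ := (exact_idealInclusion_rTensor I (J → R) (z - z')).1 (by
    rw [map_sub, he, sub_self])
  exact ⟨z', hz', s, by rw [hs]; abel⟩

theorem exists_sum_of_mem_iSup {V W : Type*} [Fintype V] [AddCommGroup W] [Module k W]
    {P : V → Submodule k W} {w : W} (h : w ∈ ⨆ v, P v) :
    ∃ y : V → W, (∀ v, y v ∈ P v) ∧ ∑ v, y v = w := by
  obtain ⟨f, hf, hs⟩ := (Submodule.mem_iSup_iff_exists_finsupp _ _).1 h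
  exact ⟨f, hf, by rw [← hs, Finsupp.sum_fintype _ _ (by simp)]⟩

-- Each edge enters with both signs, so a boundary does not change the sum over the vertices.
open Classical in
theorem sum_single_sub_boundary {V E W : Type*} [Fintype V] [Fintype E] [AddCommGroup W]
    (src tgt : E → V) (v₀ : V) (t : W) (s : E → W) :
    ∑ v, ((Pi.single v₀ t : V → W) - ∑ e, (Pi.single (src e) (s e) - Pi.single (tgt e) (s e))) v
      = t := by
  simp only [Pi.sub_apply, Finset.sum_apply]
  rw [Finset.sum_sub_distrib, Finset.sum_comm]
  simp [Finset.sum_sub_distrib, Finset.sum_pi_single']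

open Classical in
/-- The reflection property of `R` for a tree of subrings that generate it. -/
theorem BalancedReflecting.of_tree {V : Type*} {E : Type*} [Fintype V] [Fintype E] (src tgt : E → V)
    (C : V → Set R) (A : E → Set R) (hgen : Algebra.adjoin k (⋃ v, C v) = ⊤)
    (hC : ∀ v, BalancedReflecting k (C v)) (hA : ∀ e, BalancedComponentwise k (A e))
    (hsrc : ∀ e, A e ⊆ C (src e)) (htgt : ∀ e, A e ⊆ C (tgt e))
    (hconn : ∀ (W : Type uL) [AddCommGroup W] (y : V → W), ∑ v, y v = 0 →
      ∃ z : E → W, y = ∑ e, (Pi.single (src e) (z e) - Pi.single (tgt e) (z e)))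
    (hsep : ∀ (M : Type uL) [AddCommGroup M] [Module k M] [Module Rᵐᵒᵖ M] [IsScalarTower k Rᵐᵒᵖ M]
      (e₀ : E), ∃ (Z : Type uL) (_ : AddCommGroup Z) (_ : Module k Z)
        (Ψ : V → M ⊗[k] R →ₗ[k] Z), (∀ v, balancedSubmodule k (C v) M R ≤ LinearMap.ker (Ψ v)) ∧
        (∀ e ≠ e₀, Ψ (src e) = Ψ (tgt e)) ∧
        LinearMap.ker (Ψ (src e₀) - Ψ (tgt e₀)) ≤ balancedSubmodule k (A e₀) M R) :
    BalancedReflecting k (Set.univ : Set R) := by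
  intro I J t ht
  have huniv (M : Type uL) [AddCommGroup M] [Module k M] [Module Rᵐᵒᵖ M] [IsScalarTower k Rᵐᵒᵖ M] :
      balancedSubmodule k (Set.univ : Set R) M (J → R) =
        ⨆ v, balancedSubmodule k (C v) M (J → R) := by
    rw [← Algebra.coe_top (R := k), ← hgen, balancedSubmodule_adjoin, balancedSubmodule_iUnion]
  rw [huniv] at ht ⊢
  set i := (idealInclusion k I).rTensor (J → R)
  have hex := exact_idealInclusion_rTensor (k := k) I (J → R)
  set π := (idealProjection k I).rTensor (J → R)
  rcases isEmpty_or_nonempty V with hV | ⟨⟨v₀⟩⟩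
  · rw [iSup_of_empty, Submodule.mem_bot] at ht ⊢
    refine Module.Flat.rTensor_preserves_injective_linearMap (M := J → R) (idealInclusion k I)
      Subtype.val_injective ?_
    rw [map_zero]
    exact ht
  obtain ⟨y, hy, hyt⟩ := exists_sum_of_mem_iSup ht
  -- Placing `i t` at one vertex and subtracting the parts `y v` gives a family of sum zero, hence
  -- the boundary of a family `z` on the edges.
  obtain ⟨z, hz⟩ := hconn _ (Pi.single v₀ (i t) - y) (by
    simp [Finset.sum_sub_distrib, hyt, Finset.sum_pi_single'])
  have hzA (e₀) (j) : component k R (R ⧸ I) j (π (z e₀)) ∈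
      balancedSubmodule k (A e₀) (R ⧸ I) R := by
    obtain ⟨Z, _, _, Ψ, h₁, h₂, h₃⟩ := hsep (R ⧸ I) e₀
    let c := component k R (R ⧸ I) j ∘ₗ π
    -- The functional `F` kills the left side of `hz` modulo `I`, and on the right side it keeps
    -- only the contribution of `e₀`, from which `h₃` recovers that `z e₀` is balanced modulo `I`.
    let F : (V → R ⊗[k] (J → R)) →ₗ[k] Z := ∑ v, Ψ v ∘ₗ c ∘ₗ LinearMap.proj v
    have hF (v w) : F (Pi.single v w) = Ψ v (c w) := by
      simp only [F, LinearMap.sum_apply, LinearMap.comp_apply, LinearMap.proj_apply]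
      rw [Finset.sum_eq_single v]
      · simp
      · intro v' _ hv'
        simp [hv']
      · simp
    refine h₃ ?_
    have hl : F (Pi.single v₀ (i t) - y) = 0 := by
      rw [map_sub, hF]
      have e₁ : c (i t) = 0 := by
        change component k R (R ⧸ I) j (π (i t)) = 0
        rw [hex.apply_apply_eq_zero, map_zero]
      have e₂ : F y = 0 := by
        simp only [F, LinearMap.sum_apply]
        refine Finset.sum_eq_zero fun v _ => h₁ v ?_
        refine component_mem_balanced j ?_
        exact map_balancedSubmodule_le (C v) (idealProjection k I) LinearMap.id
          (fun _ _ _ => rfl) (fun _ _ _ => rfl) (hy v)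
      rw [e₁, e₂, map_zero, sub_zero]
    rw [hz, map_sum, Finset.sum_eq_single e₀ (fun e _ he => by
      rw [map_sub, hF, hF, h₂ e he, sub_self]) (by simp), map_sub, hF, hF] at hl
    exact hl
  choose z' hz' s hs using fun e => (hA e).exists_decomposition I (hzA e)
  -- The parts `s e` coming from `I` are subtracted from `t` as a boundary. What remains at `v` is
  -- balanced over `C v` in `R`, hence in `I`, and the total is still `t`.
  let u : V → I ⊗[k] (J → R) :=
    Pi.single v₀ t - ∑ e, (Pi.single (src e) (s e) - Pi.single (tgt e) (s e))
  have hu (v) : u v ∈ balancedSubmodule k (C v) I (J → R) := by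
    refine hC v I J _ ?_
    change i (u v) ∈ _
    have hi (v v' : V) (w) : i ((Pi.single v w : V → I ⊗[k] (J → R)) v') =
        (Pi.single v (i w) : V → R ⊗[k] (J → R)) v' := by
      by_cases h : v = v'
      · subst h; simp
      · simp [Pi.single_eq_of_ne' h]
    have key : i (u v) = y v +
        ∑ e, ((Pi.single (src e) (z' e) : V → R ⊗[k] (J → R)) v -
          (Pi.single (tgt e) (z' e) : V → R ⊗[k] (J → R)) v) := by
      have h := congrFun hz v
      simp only [Pi.sub_apply, Finset.sum_apply, hs, Pi.single_add, Pi.add_apply] at h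
      simp only [u, Pi.sub_apply, Finset.sum_apply, map_sub, map_sum, hi]
      rw [sub_eq_iff_eq_add] at h
      rw [h, add_comm _ (y v), add_sub_assoc, ← Finset.sum_sub_distrib]
      congr 1
      refine Finset.sum_congr rfl fun e _ => ?_
      simp only [i]
      abel
    rw [key]
    refine Submodule.add_mem _ (hy v) (Submodule.sum_mem _ fun e _ => Submodule.sub_mem _ ?_ ?_)
    · by_cases h : src e = v
      · subst h
        simpa using balancedSubmodule_mono (hsrc e) (hz' e)
      · simp [Pi.single_eq_of_ne' h]
    · by_cases h : tgt e = v
      · subst h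
        simpa using balancedSubmodule_mono (htgt e) (hz' e)
      · simp [Pi.single_eq_of_ne' h]
  have ht' : ∑ v, u v = t := sum_single_sub_boundary src tgt v₀ t s
  rw [← ht']
  exact Submodule.sum_mem _ fun v _ => Submodule.mem_iSup_of_mem v (hu v)

open Classical in
/-- The reflection property of `R` if it is generated by a subring and by elements with which
commutation leads from certain smaller subrings to the subring. -/
theorem BalancedReflecting.of_stableLetters {E : Type*} [Fintype E] (C : Set R) (A : E → Set R)
    (r : E → R) (hgen : Algebra.adjoin k (C ∪ Set.range r) = ⊤) (hC : BalancedReflecting k C)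
    (hA : ∀ e, BalancedComponentwise k (A e)) (hAC : ∀ e, A e ⊆ C)
    (hr : ∀ e, ∀ a ∈ A e, r e * a - a * r e ∈ C)
    (hsep : ∀ (M : Type uL) [AddCommGroup M] [Module k M] [Module Rᵐᵒᵖ M] [IsScalarTower k Rᵐᵒᵖ M]
      (e₀ : E), ∃ (Z : Type uL) (_ : AddCommGroup Z) (_ : Module k Z)
        (Ψ : M ⊗[k] R →ₗ[k] Z), balancedSubmodule k C M R ≤ LinearMap.ker Ψ ∧
        (∀ e ≠ e₀, Ψ ∘ₗ balancingMap k (r e) M R = 0) ∧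
        LinearMap.ker (Ψ ∘ₗ balancingMap k (r e₀) M R) ≤ balancedSubmodule k (A e₀) M R) :
    BalancedReflecting k (Set.univ : Set R) := by
  intro I J t ht
  have huniv (M : Type uL) [AddCommGroup M] [Module k M] [Module Rᵐᵒᵖ M] [IsScalarTower k Rᵐᵒᵖ M] :
      balancedSubmodule k (Set.univ : Set R) M (J → R) = balancedSubmodule k C M (J → R) ⊔
        ⨆ e, LinearMap.range (balancingMap k (r e) M (J → R)) := by
    rw [← Algebra.coe_top (R := k), ← hgen, balancedSubmodule_adjoin, balancedSubmodule_union,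
      ← Set.iUnion_singleton_eq_range, balancedSubmodule_iUnion]
    simp only [balancedSubmodule_singleton]
  rw [huniv] at ht ⊢
  set i := (idealInclusion k I).rTensor (J → R)
  have hex := exact_idealInclusion_rTensor (k := k) I (J → R)
  set π := (idealProjection k I).rTensor (J → R)
  obtain ⟨y, hy, y', hy', hyt⟩ := Submodule.mem_sup.1 ht
  obtain ⟨w, hw, rfl⟩ := exists_sum_of_mem_iSup hy'
  choose z hz using hw
  have hπb (e) (w) : π (balancingMap k (r e) R (J → R) w) =
      balancingMap k (r e) (R ⧸ I) (J → R) (π w) :=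
    map_balancingMap (r e) (idealProjection k I) LinearMap.id (fun _ => rfl) (fun _ => rfl) w
  have hib (e) (w) : i (balancingMap k (r e) I (J → R) w) =
      balancingMap k (r e) R (J → R) (i w) :=
    map_balancingMap (r e) (idealInclusion k I) LinearMap.id (fun _ => rfl) (fun _ => rfl) w
  have hzA (e₀) (j) : component k R (R ⧸ I) j (π (z e₀)) ∈
      balancedSubmodule k (A e₀) (R ⧸ I) R := by
    obtain ⟨Z, _, _, Ψ, h₁, h₂, h₃⟩ := hsep (R ⧸ I) e₀
    let c := component k R (R ⧸ I) j
    have hcb (e) (w) : c (balancingMap k (r e) (R ⧸ I) (J → R) w) =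
        balancingMap k (r e) (R ⧸ I) R (c w) := component_balancingMap (r e) j w
    refine h₃ ?_
    have hl : Ψ (c (π (i t))) = 0 := by rw [hex.apply_apply_eq_zero, map_zero, map_zero]
    have hy₀ : Ψ (c (π y)) = 0 := by
      refine h₁ (component_mem_balanced j ?_)
      exact map_balancedSubmodule_le C (idealProjection k I) LinearMap.id
        (fun _ _ _ => rfl) (fun _ _ _ => rfl) hy
    rw [← hyt, map_add, map_add, map_add, hy₀, zero_add, map_sum, map_sum, map_sum,
      Finset.sum_eq_single e₀ (fun e _ he => by
        rw [← hz, hπb, hcb]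
        exact DFunLike.congr_fun (h₂ e he) _) (by simp), ← hz, hπb, hcb] at hl
    exact hl
  choose z' hz' s hs using fun e => (hA e).exists_decomposition I (hzA e)
  -- After removal of the parts `s e` coming from `I`, the stable letters act only on tensors
  -- balanced over `A e`, so by the commutator condition the result is balanced over `C`.
  have key : t - ∑ e, balancingMap k (r e) I (J → R) (s e) ∈ balancedSubmodule k C I (J → R) := by
    refine hC I J _ ?_
    change i _ ∈ _
    have : i (t - ∑ e, balancingMap k (r e) I (J → R) (s e)) =
        y + ∑ e, balancingMap k (r e) R (J → R) (z' e) := by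
      rw [map_sub, ← hyt, map_sum, add_sub_assoc, ← Finset.sum_sub_distrib]
      congr 1
      refine Finset.sum_congr rfl fun e _ => ?_
      rw [hib, ← hz, hs, map_add, add_sub_assoc]
      simp only [i]
      abel
    rw [this]
    exact Submodule.add_mem _ hy (Submodule.sum_mem _ fun e _ =>
      balancingMap_mem_of_mem (hAC e) (hr e) (hz' e))
  rw [← sub_add_cancel t (∑ e, balancingMap k (r e) I (J → R) (s e))]
  exact Submodule.add_mem_sup key (Submodule.sum_mem _ fun e _ =>
    Submodule.mem_iSup_of_mem e ⟨_, rfl⟩)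

end Chase

/-! ### Deformed representations that separate the edges. -/

section Shear

variable {k : Type uk} [Field k] {R : Type uL} [Ring R] [Algebra k R] (A : Set R)
  (M : Type uL) [AddCommGroup M] [Module k M] [Module Rᵐᵒᵖ M]

/-- The right `R`-module `M ⊗[A] R`. -/
abbrev BalancedTensor (k : Type uk) [Field k] {R : Type uL} [Ring R] [Algebra k R] (A : Set R)
    (M : Type uL) [AddCommGroup M] [Module k M] [Module Rᵐᵒᵖ M] : Type uL :=
  (M ⊗[k] R) ⧸ balancedSubmodule k A M R

namespace BalancedTensor

/-- The right multiplication on `M ⊗[A] R`. -/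
def mulRight (r : R) : Module.End k (BalancedTensor k A M) :=
  Submodule.mapQ _ _ ((LinearMap.mulRight k r).lTensor M) <|
    map_balancedSubmodule_le A LinearMap.id (LinearMap.mulRight k r) (fun _ _ _ => rfl)
      fun s _ x => mul_assoc s x r

/-- The map `m ↦ m ⊗ 1`. -/
def of : M →ₗ[k] BalancedTensor k A M :=
  (balancedSubmodule k A M R).mkQ ∘ₗ (TensorProduct.mk k M R).flip 1

variable {A M}

theorem mulRight_mk (r s : R) (m : M) :
    mulRight A M r ((balancedSubmodule k A M R).mkQ (m ⊗ₜ s)) =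
      (balancedSubmodule k A M R).mkQ (m ⊗ₜ (s * r)) := rfl

theorem mulRight_of (r : R) (m : M) :
    mulRight A M r (of A M m) = (balancedSubmodule k A M R).mkQ (m ⊗ₜ r) := by
  change mulRight A M r ((balancedSubmodule k A M R).mkQ (m ⊗ₜ 1)) = _
  rw [mulRight_mk, one_mul]

theorem of_smul {a : R} (ha : a ∈ A) (m : M) :
    of (k := k) A M (op a • m) = mulRight A M a (of A M m) := by
  rw [mulRight_of, ← sub_eq_zero]
  refine (Submodule.Quotient.mk_eq_zero _).2 ?_
  simpa using balanced_tmul (k := k) (X := R) ha m 1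

@[ext]
theorem hom_ext {P : Type*} [AddCommGroup P] [Module k P] {f g : BalancedTensor k A M →ₗ[k] P}
    (h : ∀ m s, f ((balancedSubmodule k A M R).mkQ (m ⊗ₜ s)) =
      g ((balancedSubmodule k A M R).mkQ (m ⊗ₜ s))) : f = g :=
  Submodule.linearMap_qext _ (TensorProduct.ext' h)

theorem mulRight_one : mulRight (k := k) A M (1 : R) = 1 :=
  hom_ext fun m s => by rw [mulRight_mk, mul_one]; rfl

theorem mulRight_mul (r r' : R) :
    mulRight (k := k) A M (r * r') = mulRight A M r' ∘ₗ mulRight A M r :=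
  hom_ext fun m s => by
    rw [LinearMap.comp_apply, mulRight_mk, mulRight_mk, mulRight_mk, mul_assoc]

theorem mulRight_add (r r' : R) :
    mulRight (k := k) A M (r + r') = mulRight A M r + mulRight A M r' :=
  hom_ext fun m s => by
    rw [LinearMap.add_apply, mulRight_mk, mulRight_mk, mulRight_mk, mul_add, tmul_add, map_add]

theorem mulRight_algebraMap (c : k) :
    mulRight A M (algebraMap k R c) = algebraMap k (Module.End k (BalancedTensor k A M)) c :=
  hom_ext fun m s => by
    rw [mulRight_mk, ← Algebra.commutes, ← Algebra.smul_def, tmul_smul, map_smul,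
      Module.algebraMap_end_apply]

end BalancedTensor

variable [IsScalarTower k Rᵐᵒᵖ M]

open BalancedTensor

/-- The right action of `R` on `M × (M ⊗[A] R)`. -/
def diagonalAction : R →ₐ[k] (Module.End k (M × BalancedTensor k A M))ᵐᵒᵖ :=
  AlgHom.ofLinearMap
    { toFun := fun r => op ((Algebra.lsmul k k M (op r)).prodMap (mulRight A M r))
      map_add' := fun r r' => by
        rw [mulRight_add, op_add, map_add, LinearMap.prodMap_add, op_add]
      map_smul' := fun c r => by
        have : mulRight (k := k) A M (c • r) = c • mulRight A M r := by
          rw [Algebra.smul_def, Algebra.commutes, mulRight_mul, mulRight_algebraMap]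
          rfl
        rw [this, op_smul, map_smul, LinearMap.prodMap_smul, op_smul]
        rfl }
    (by
      refine unop_injective (LinearMap.ext fun x => Prod.ext (one_smul Rᵐᵒᵖ x.1) ?_)
      change mulRight A M (1 : R) x.2 = x.2
      rw [mulRight_one, Module.End.one_apply])
    fun r r' => by
      refine unop_injective (LinearMap.ext fun x => Prod.ext (mul_smul (op r') (op r) x.1) ?_)
      change mulRight A M (r * r') x.2 = mulRight A M r' (mulRight A M r x.2)
      rw [mulRight_mul, LinearMap.comp_apply]

variable {A M}

theorem diagonalAction_apply (r : R) (m : M) (p : BalancedTensor k A M) :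
    unop (diagonalAction A M r) (m, p) = (op r • m, mulRight A M r p) := rfl

/-- The nilpotent endomorphism `(m, p) ↦ (0, q m)` of `M × (M ⊗[A] R)`. -/
def shearPart (q : M →ₗ[k] BalancedTensor k A M) :
    (Module.End k (M × BalancedTensor k A M))ᵐᵒᵖ :=
  op (LinearMap.inr k M _ ∘ₗ q ∘ₗ LinearMap.fst k M _)

omit [IsScalarTower k Rᵐᵒᵖ M] in
theorem shearPart_apply (q : M →ₗ[k] BalancedTensor k A M) (x) :
    unop (shearPart q) x = (0, q x.1) := rfl

omit [IsScalarTower k Rᵐᵒᵖ M] in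
theorem shearPart_mul (q q' : M →ₗ[k] BalancedTensor k A M) :
    shearPart q * shearPart q' = 0 := by
  refine unop_injective (LinearMap.ext fun x => ?_)
  simp [shearPart]

omit [IsScalarTower k Rᵐᵒᵖ M] in
theorem shearPart_add (q q' : M →ₗ[k] BalancedTensor k A M) :
    shearPart (q + q') = shearPart q + shearPart q' := by
  refine unop_injective (LinearMap.ext fun x => ?_)
  simp [shearPart]

theorem shearPart_commute {q : M →ₗ[k] BalancedTensor k A M} {a : R}
    (h : ∀ m, q (op a • m) = mulRight A M a (q m)) :
    Commute (shearPart q) (diagonalAction A M a) := by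
  refine unop_injective (LinearMap.ext fun x => ?_)
  rw [unop_mul, unop_mul, Module.End.mul_apply, Module.End.mul_apply]
  change (op a • (0 : M), mulRight A M a (q x.1)) = (0, q (op a • x.1))
  rw [h, smul_zero]

/-- The unipotent automorphism `(m, p) ↦ (m, p + q m)` of `M × (M ⊗[A] R)`. -/
def shear (q : M →ₗ[k] BalancedTensor k A M) :
    (Module.End k (M × BalancedTensor k A M))ᵐᵒᵖˣ where
  val := 1 + shearPart q
  inv := 1 + shearPart (-q)
  val_inv := by
    rw [add_mul, mul_add, mul_add, shearPart_mul, one_mul, mul_one, one_mul, add_zero, add_assoc,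
      ← shearPart_add, neg_add_cancel]
    simp [shearPart]
  inv_val := by
    rw [add_mul, mul_add, mul_add, shearPart_mul, one_mul, mul_one, one_mul, add_zero, add_assoc,
      ← shearPart_add, add_neg_cancel]
    simp [shearPart]

omit [IsScalarTower k Rᵐᵒᵖ M] in
theorem shear_add (q q' : M →ₗ[k] BalancedTensor k A M) :
    shear (q + q') = shear q * shear q' := by
  refine Units.ext ?_
  change 1 + shearPart (q + q') = (1 + shearPart q) * (1 + shearPart q')
  rw [add_mul, mul_add, mul_add, shearPart_mul, one_mul, mul_one, one_mul, add_zero, shearPart_add]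
  abel

omit [IsScalarTower k Rᵐᵒᵖ M] in
theorem shear_apply (q : M →ₗ[k] BalancedTensor k A M) (x) :
    unop (shear q : (Module.End k (M × BalancedTensor k A M))ᵐᵒᵖ) x = (x.1, x.2 + q x.1) := by
  change x + (0, q x.1) = _
  ext <;> simp

/-- Deformations do not affect the submodule `0 × (M ⊗[A] R)`. There `ρ` is the ordinary right
multiplication, since the two agree on generators. -/
theorem apply_zero_prod {S : Set R} (hS : Algebra.adjoin k S = ⊤)
    {ρ : R →ₐ[k] (Module.End k (M × BalancedTensor k A M))ᵐᵒᵖ}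
    (h : ∀ s ∈ S, ∀ p, unop (ρ s) (0, p) = (0, mulRight A M s p)) (r : R) (p) :
    unop (ρ r) (0, p) = (0, mulRight A M r p) := by
  have hr : r ∈ Algebra.adjoin k S := hS ▸ trivial
  have hd (r : R) (p) : ((0 : M), mulRight (k := k) A M r p) =
      unop (diagonalAction A M r) (0, p) := by
    rw [diagonalAction_apply, smul_zero]
  simp only [hd] at h ⊢
  induction hr using Algebra.adjoin_induction generalizing p with
  | mem s hs => exact h s hs p
  | algebraMap c => rw [AlgHom.commutes, AlgHom.commutes]
  | add r r' _ _ hr hr' =>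
    rw [map_add, map_add, unop_add, unop_add, LinearMap.add_apply, LinearMap.add_apply, hr, hr']
  | mul r r' _ _ hr hr' =>
    rw [map_mul, map_mul, unop_mul, unop_mul, Module.End.mul_apply, Module.End.mul_apply, hr,
      ← hd, hr']

/-- The map `m ⊗ r ↦ (m, q m) ρ(r)`. -/
noncomputable def orbitMap (ρ : R →ₐ[k] (Module.End k (M × BalancedTensor k A M))ᵐᵒᵖ)
    (q : M →ₗ[k] BalancedTensor k A M) : M ⊗[k] R →ₗ[k] M × BalancedTensor k A M :=
  TensorProduct.lift <| LinearMap.mk₂ k (fun m r => unop (ρ r) (m, q m))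
    (fun m m' r => by rw [q.map_add, ← Prod.mk_add_mk, LinearMap.map_add])
    (fun c m r => by rw [q.map_smul, ← Prod.smul_mk, LinearMap.map_smul])
    (fun m r r' => by simp) (fun c m r => by simp)

omit [IsScalarTower k Rᵐᵒᵖ M] in
theorem orbitMap_tmul (ρ : R →ₐ[k] (Module.End k (M × BalancedTensor k A M))ᵐᵒᵖ)
    (q : M →ₗ[k] BalancedTensor k A M) (m : M) (r : R) :
    orbitMap ρ q (m ⊗ₜ r) = unop (ρ r) (m, q m) := rfl

omit [IsScalarTower k Rᵐᵒᵖ M] in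
theorem balancedSubmodule_le_ker_orbitMap {C : Set R}
    {ρ : R →ₐ[k] (Module.End k (M × BalancedTensor k A M))ᵐᵒᵖ}
    {q : M →ₗ[k] BalancedTensor k A M}
    (h : ∀ c ∈ C, ∀ m, unop (ρ c) (m, q m) = (op c • m, q (op c • m))) :
    balancedSubmodule k C M R ≤ LinearMap.ker (orbitMap ρ q) := by
  refine balancedSubmodule_le_iff.2 fun c hc m r => ?_
  rw [LinearMap.mem_ker, map_sub, orbitMap_tmul, orbitMap_tmul, smul_eq_mul, map_mul, unop_mul,
    Module.End.mul_apply, h c hc, sub_self]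

/-- The separating maps for a tree of rings. -/
theorem exists_separating_of_conj {V E : Type*} {src tgt : E → V} {C : V → Set R}
    (hgen : Algebra.adjoin k (⋃ v, C v) = ⊤) (e₀ : E)
    (ρ : R →ₐ[k] (Module.End k (M × BalancedTensor k A M))ᵐᵒᵖ)
    (q : V → M →ₗ[k] BalancedTensor k A M)
    (hρ : ∀ v, ∀ c ∈ C v, ρ c =
      ((shear (q v))⁻¹).val * diagonalAction A M c * (shear (q v)).val)
    (hq : ∀ e ≠ e₀, q (src e) = q (tgt e)) (hq₀ : q (src e₀) = q (tgt e₀) + BalancedTensor.of A M) :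
    ∃ (Z : Type uL) (_ : AddCommGroup Z) (_ : Module k Z)
        (Ψ : V → M ⊗[k] R →ₗ[k] Z), (∀ v, balancedSubmodule k (C v) M R ≤ LinearMap.ker (Ψ v)) ∧
        (∀ e ≠ e₀, Ψ (src e) = Ψ (tgt e)) ∧
        LinearMap.ker (Ψ (src e₀) - Ψ (tgt e₀)) ≤ balancedSubmodule k A M R := by
  have hinv (q : M →ₗ[k] BalancedTensor k A M) (x) :
      unop (↑(shear q)⁻¹ : (Module.End k (M × BalancedTensor k A M))ᵐᵒᵖ) x =
        (x.1, x.2 - q x.1) := by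
    change x + (0, (-q) x.1) = _
    ext <;> simp [sub_eq_add_neg]
  have hρ' (v) (c) (hc : c ∈ C v) (x) : unop (ρ c) x =
      (op c • x.1, mulRight A M c (x.2 - q v x.1) + q v (op c • x.1)) := by
    rw [hρ v c hc, unop_mul, unop_mul, Module.End.mul_apply, Module.End.mul_apply, hinv,
      diagonalAction_apply, shear_apply]
  have hρ₀ := apply_zero_prod (ρ := ρ) hgen (fun s hs p => by
    obtain ⟨v, hv⟩ := Set.mem_iUnion.1 hs
    simp [hρ' v s hv])
  refine ⟨_, inferInstance, inferInstance, fun v => orbitMap ρ (q v), fun v => ?_,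
    fun e he => ?_, ?_⟩
  · exact balancedSubmodule_le_ker_orbitMap fun c hc m => by simp [hρ' v c hc]
  · simp only [hq e he]
  -- The two starting vectors differ by `(0, m ⊗ 1)`, on which `r` acts in the undeformed way. The
  -- difference of the maps is therefore the projection to `M ⊗[A] R`.
  · have : orbitMap ρ (q (src e₀)) - orbitMap ρ (q (tgt e₀)) =
        LinearMap.inr k M _ ∘ₗ (balancedSubmodule k A M R).mkQ := by
      refine TensorProduct.ext' fun m r => ?_
      rw [LinearMap.sub_apply, orbitMap_tmul, orbitMap_tmul, ← map_sub, hq₀, LinearMap.add_apply,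
        Prod.mk_sub_mk, sub_self, add_sub_cancel_left, hρ₀, mulRight_of]
      rfl
    rw [this]
    intro t ht
    have := congrArg Prod.snd (LinearMap.mem_ker.1 ht)
    exact (Submodule.Quotient.mk_eq_zero _).1 this

open Classical in
/-- The separating map for a ring generated by a subring and stable letters. -/
theorem exists_separating_of_add {E : Type*} {C : Set R} {t : E → R}
    (hgen : Algebra.adjoin k (C ∪ Set.range t) = ⊤) (e₀ : E)
    (ρ : R →ₐ[k] (Module.End k (M × BalancedTensor k A M))ᵐᵒᵖ)
    (hρ : ∀ c ∈ C, ρ c = diagonalAction A M c)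
    (ht : ∀ e ≠ e₀, ρ (t e) = diagonalAction A M (t e))
    (ht₀ : ρ (t e₀) = diagonalAction A M (t e₀) + shearPart (BalancedTensor.of A M)) :
    ∃ (Z : Type uL) (_ : AddCommGroup Z) (_ : Module k Z)
        (Ψ : M ⊗[k] R →ₗ[k] Z), balancedSubmodule k C M R ≤ LinearMap.ker Ψ ∧
        (∀ e ≠ e₀, Ψ ∘ₗ balancingMap k (t e) M R = 0) ∧
        LinearMap.ker (Ψ ∘ₗ balancingMap k (t e₀) M R) ≤ balancedSubmodule k A M R := by
  have ht₀' (x) : unop (ρ (t e₀)) x =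
      (op (t e₀) • x.1, mulRight A M (t e₀) x.2 + BalancedTensor.of A M x.1) := by
    rw [ht₀, unop_add, LinearMap.add_apply, shearPart_apply]
    change (op (t e₀) • x.1, mulRight A M (t e₀) x.2) + _ = _
    rw [Prod.mk_add_mk, add_zero]
  have hd (r : R) (p) : unop (diagonalAction A M r) (0, p) =
      ((0 : M), mulRight (k := k) A M r p) := by
    rw [diagonalAction_apply, smul_zero]
  have hρ₀ := apply_zero_prod (ρ := ρ) hgen (fun s hs p => by
    rcases hs with hs | ⟨e, rfl⟩
    · rw [hρ s hs, hd]
    · by_cases he : e = e₀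
      · subst he; simp [ht₀']
      · rw [ht e he, hd])
  refine ⟨_, inferInstance, inferInstance, orbitMap ρ 0, ?_, fun e he => ?_, ?_⟩
  · exact balancedSubmodule_le_ker_orbitMap fun c hc m => by
      rw [hρ c hc, diagonalAction_apply]; simp
  · refine TensorProduct.ext' fun m r => ?_
    rw [LinearMap.comp_apply, balancingMap_tmul, map_sub, orbitMap_tmul, orbitMap_tmul,
      smul_eq_mul, map_mul, unop_mul, Module.End.mul_apply, ht e he, diagonalAction_apply]
    simp
  -- The deformed letter sends `(m, 0)` to `(m t, m ⊗ 1)`. The second component is all that survives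
  -- in the difference, with a minus sign.
  · have : orbitMap ρ 0 ∘ₗ balancingMap k (t e₀) M R =
        -(LinearMap.inr k M _ ∘ₗ (balancedSubmodule k A M R).mkQ) := by
      refine TensorProduct.ext' fun m r => ?_
      rw [LinearMap.comp_apply, balancingMap_tmul, map_sub, orbitMap_tmul, orbitMap_tmul,
        smul_eq_mul, map_mul, unop_mul, Module.End.mul_apply, ht₀', ← map_sub, Prod.mk_sub_mk]
      simp only [LinearMap.zero_apply, map_zero, zero_add, sub_self, zero_sub]
      rw [hρ₀, map_neg, mulRight_of]
      ext <;> simp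
    rw [this]
    intro t ht
    have := congrArg Prod.snd (LinearMap.mem_ker.1 ht)
    exact (Submodule.Quotient.mk_eq_zero _).1 (neg_eq_zero.1 this)

end Shear

/-! ### Solving equations along forests -/

namespace OrientedGraph

/-- Every prescribed family of quotients along the edges in `S` comes from a family of group
elements at the vertices. -/
def Solvable.{w, v, e} {V : Type v} {E : Type e} (G : OrientedGraph V E) (S : Set E) : Prop :=
  ∀ (Γ : Type w) [Group Γ] (h : E → Γ), ∃ g : V → Γ, ∀ e ∈ S, g (G.src e) = g (G.tgt e) * h e

universe w

variable {V : Type*} {E : Type*} {G : OrientedGraph V E}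

theorem Joined.mono {S S' : Set E} (h : S ⊆ S') {v w : V} (hj : G.Joined S v w) :
    G.Joined S' v w :=
  Relation.EqvGen.mono (fun _ _ ⟨e, he, h₁, h₂⟩ => ⟨e, h he, h₁, h₂⟩) _ _ hj

theorem joined_of_mem {S : Set E} {e : E} (he : e ∈ S) : G.Joined S (G.src e) (G.tgt e) :=
  Relation.EqvGen.rel _ _ ⟨e, he, rfl, rfl⟩

/-- Left multiplication by a constant on one component preserves the equations of `S`. As the ends
of `e` lie in different components, the constant can be chosen to satisfy the equation of `e`. -/
theorem Solvable.insert {S : Set E} (hS : Solvable.{w} G S) {e : E}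
    (he : ¬ G.Joined S (G.src e) (G.tgt e)) : Solvable.{w} G (insert e S) := by
  classical
  intro Γ _ h
  obtain ⟨g, hg⟩ := hS Γ h
  let c : Γ := g (G.src e) * (h e)⁻¹ * (g (G.tgt e))⁻¹
  refine ⟨fun v => if G.Joined S (G.tgt e) v then c * g v else g v, fun e' he' => ?_⟩
  beta_reduce
  rcases he' with rfl | he'
  · have h₁ : G.Joined S (G.tgt e') (G.tgt e') := Relation.EqvGen.refl _
    have h₂ : ¬ G.Joined S (G.tgt e') (G.src e') := fun h => he (Relation.EqvGen.symm _ _ h)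
    rw [if_neg h₂, if_pos h₁]
    simp [c, mul_assoc]
  · have hj := joined_of_mem (G := G) he'
    by_cases ht : G.Joined S (G.tgt e) (G.tgt e')
    · have h' : G.Joined S (G.tgt e) (G.src e') :=
        Relation.EqvGen.trans _ _ _ ht (Relation.EqvGen.symm _ _ hj)
      rw [if_pos ht, if_pos h', hg e' he']
      exact (mul_assoc _ _ _).symm
    · have h' : ¬ G.Joined S (G.tgt e) (G.src e') :=
        fun h => ht (Relation.EqvGen.trans _ _ _ h hj)
      rw [if_neg ht, if_neg h', hg e' he']

theorem IsForest.solvable {S : Set E} (hfin : S.Finite) (hS : G.IsForest S) : Solvable.{w} G S := by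
  induction S, hfin using Set.Finite.induction_on with
  | empty => exact fun Γ _ h => ⟨fun _ => 1, by simp⟩
  | @insert e S he _ ih =>
    have hF : G.IsForest S := fun f hf hj =>
      hS f (Or.inr hf) (hj.mono (Set.sdiff_subset_sdiff_left (Set.subset_insert _ _)))
    exact (ih hF).insert fun hj =>
      hS e (Or.inl rfl) (hj.mono (Set.subset_sdiff_singleton (Set.subset_insert e S) he))

/-- The graph with an additional edge for each pair of vertices. -/
def complete (G : OrientedGraph V E) : OrientedGraph V (E ⊕ V × V) where
  src := Sum.elim G.src Prod.fst
  tgt := Sum.elim G.tgt Prod.snd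

/-- A finite forest can be completed to a tree by additional edges. -/
theorem exists_connected_extension (G : OrientedGraph V E) [Finite V] [Finite E] {T : Set E}
    (hT : Solvable.{w} G T) :
    ∃ S : Set (E ⊕ V × V), Sum.inl '' T ⊆ S ∧ (∀ e, Sum.inl e ∈ S → e ∈ T) ∧
      Solvable.{w} G.complete S ∧ ∀ v w, G.complete.Joined S v w := by
  let P : Set (E ⊕ V × V) → Prop :=
    fun S => (∀ e, Sum.inl e ∈ S → e ∈ T) ∧ Solvable.{w} G.complete S
  have h₀ : P (Sum.inl '' T) := by
    refine ⟨by simp, fun Γ _ h => ?_⟩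
    obtain ⟨g, hg⟩ := hT Γ (h ∘ Sum.inl)
    refine ⟨g, ?_⟩
    rintro _ ⟨e, he, rfl⟩
    exact hg e he
  -- A maximal solvable set is connected: an added edge between vertices that are not joined would
  -- keep it solvable.
  obtain ⟨S, hle, hS⟩ := (Set.toFinite {S | P S}).exists_le_maximal h₀
  refine ⟨S, hle, hS.prop.1, hS.prop.2, fun v w => ?_⟩
  by_contra hj
  have hP : P (insert (Sum.inr (v, w)) S) :=
    ⟨fun e he => hS.prop.1 e (by simpa using he), hS.prop.2.insert hj⟩
  exact hj (joined_of_mem (hS.le_of_ge hP (Set.subset_insert _ _) (Set.mem_insert _ _)))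

open Classical in
theorem Joined.exists_boundary [Fintype V] {S : Set E} [Fintype S] {W : Type*} [AddCommGroup W]
    {v w : V} (h : G.Joined S v w) (x : W) : ∃ z : S → W,
      (Pi.single v x - Pi.single w x : V → W) =
        ∑ e : S, (Pi.single (G.src e) (z e) - Pi.single (G.tgt e) (z e)) := by
  induction h with
  | rel v w h =>
    obtain ⟨e, he, rfl, rfl⟩ := h
    refine ⟨Pi.single ⟨e, he⟩ x, ?_⟩
    rw [Finset.sum_eq_single ⟨e, he⟩]
    · simp
    · intro f _ hf
      simp [hf]
    · simp
  | refl v => exact ⟨0, by simp⟩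
  | symm v w _ ih =>
    obtain ⟨z, hz⟩ := ih
    refine ⟨-z, ?_⟩
    rw [← neg_sub, hz, ← Finset.sum_neg_distrib]
    refine Finset.sum_congr rfl fun e _ => ?_
    simp only [Pi.neg_apply, Pi.single_neg]
    abel
  | trans u v w _ _ ih ih' =>
    obtain ⟨z, hz⟩ := ih
    obtain ⟨z', hz'⟩ := ih'
    refine ⟨z + z', ?_⟩
    rw [← sub_add_sub_cancel _ (Pi.single v x), hz, hz', ← Finset.sum_add_distrib]
    refine Finset.sum_congr rfl fun e _ => ?_
    simp only [Pi.add_apply, Pi.single_add]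
    abel

-- Moving the values `y v` along paths to one vertex `w` changes `y` by a boundary and accumulates
-- the total, which is zero, at `w`.
open Classical in
theorem exists_eq_boundary [Fintype V] {S : Set E} [Fintype S] (hS : ∀ v w, G.Joined S v w)
    {W : Type*} [AddCommGroup W] (y : V → W) (hy : ∑ v, y v = 0) : ∃ z : S → W,
      y = ∑ e : S, (Pi.single (G.src e) (z e) - Pi.single (G.tgt e) (z e)) := by
  rcases isEmpty_or_nonempty V with hV | ⟨⟨w⟩⟩
  · exact ⟨0, Subsingleton.elim _ _⟩
  choose z hz using fun v => (hS v w).exists_boundary (y v)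
  refine ⟨∑ v, z v, ?_⟩
  have h₁ : y = ∑ v, (Pi.single v (y v) - Pi.single w (y v)) := by
    rw [Finset.sum_sub_distrib, Finset.univ_sum_single]
    have : ∑ v, (Pi.single w (y v) : V → W) = Pi.single w (∑ v, y v) :=
      (map_sum (AddMonoidHom.single (fun _ : V => W) w) y _).symm
    rw [this, hy, Pi.single_zero, sub_zero]
  have h₂ (v₀ : V) (x : V → W) : (Pi.single v₀ (∑ v, x v) : V → W) = ∑ v, Pi.single v₀ (x v) :=
    map_sum (AddMonoidHom.single (fun _ : V => W) v₀) x _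
  rw [h₁]
  simp only [hz, Finset.sum_apply, h₂]
  rw [Finset.sum_comm]
  simp only [Finset.sum_sub_distrib]

end OrientedGraph

/-! ### Universal properties -/

namespace PresentedLieAlgebra

variable {k : Type*} [Field k] {X : Type*} {R : Set (FreeLieAlgebra k X)} {F : Type*} [LieRing F]
  [LieAlgebra k F]

/-- The canonical homomorphism from the free Lie algebra. -/
noncomputable def mk (R : Set (FreeLieAlgebra k X)) :
    FreeLieAlgebra k X →ₗ⁅k⁆ PresentedLieAlgebra k R :=
  { (LieSubmodule.Quotient.mk' (LieSubmodule.lieSpan k (FreeLieAlgebra k X) R)).toLinearMap with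
    map_lie' := fun {x y} => LieSubmodule.Quotient.mk_bracket _ x y }

theorem mk_surjective : Function.Surjective (mk R) :=
  LieSubmodule.Quotient.surjective_mk' _

/-- The homomorphism determined by the images of the generators. -/
noncomputable def lift (f : FreeLieAlgebra k X →ₗ⁅k⁆ F) (hf : ∀ r ∈ R, f r = 0) :
    PresentedLieAlgebra k R →ₗ⁅k⁆ F :=
  have h : LieSubmodule.lieSpan k (FreeLieAlgebra k X) R ≤ f.ker :=
    LieSubmodule.lieSpan_le.2 fun r hr => LieHom.mem_ker.2 (hf r hr)
  { (LieSubmodule.lieSpan k (FreeLieAlgebra k X) R).toSubmodule.liftQ f.toLinearMap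
      fun x hx => LieHom.mem_ker.1 (h hx) with
    map_lie' := by
      intro x y
      obtain ⟨x, rfl⟩ := mk_surjective x
      obtain ⟨y, rfl⟩ := mk_surjective y
      rw [← LieHom.map_lie]
      exact f.map_lie x y }

theorem lift_mk (f : FreeLieAlgebra k X →ₗ⁅k⁆ F) (hf : ∀ r ∈ R, f r = 0) (x) :
    lift f hf (mk R x) = f x := rfl

theorem hom_ext {f g : PresentedLieAlgebra k R →ₗ⁅k⁆ F}
    (h : ∀ x, f (mk R (FreeLieAlgebra.of k x)) = g (mk R (FreeLieAlgebra.of k x))) : f = g := by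
  have h' : f.comp (mk R) = g.comp (mk R) := FreeLieAlgebra.hom_ext h
  refine LieHom.ext fun x => ?_
  obtain ⟨x, rfl⟩ := mk_surjective x
  exact DFunLike.congr_fun h' x

theorem mk_eq_zero {r : FreeLieAlgebra k X} (hr : r ∈ R) : mk R r = 0 :=
  (LieSubmodule.Quotient.mk_eq_zero _).2 (LieSubmodule.subset_lieSpan hr)

end PresentedLieAlgebra

namespace PreGraphOfLieAlgebras

variable {k : Type uk} [Field k] {V : Type uV} {E : Type uE}
  (D : PreGraphOfLieAlgebras.{uk, uV, uE, uL, uM} k V E)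

section

variable {F F' : Type*} [LieRing F] [LieAlgebra k F] [LieRing F'] [LieAlgebra k F']

variable {D} in
theorem TreeRelator.map {g : ∀ v, D.vertexAlg v → F} (f : F →ₗ⁅k⁆ F') {r : F}
    (hr : D.TreeRelator g r) : D.TreeRelator (fun v x => f (g v x)) (f r) := by
  induction hr with
  | add v x y => simpa using TreeRelator.add (D := D) (g := fun v x => f (g v x)) v x y
  | smul v c x => simpa using TreeRelator.smul (D := D) (g := fun v x => f (g v x)) v c x
  | lie v x y => simpa using TreeRelator.lie (D := D) (g := fun v x => f (g v x)) v x y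
  | amalgam e a => simpa using TreeRelator.amalgam (D := D) (g := fun v x => f (g v x)) e a

variable {D} in
theorem TreeRelator.eq_zero {g : ∀ v, D.vertexAlg v →ₗ⁅k⁆ F}
    (hg : ∀ (e : {e : E // e ∈ D.T}) (a : D.edgeAlg e),
      g (D.src e) (D.σ e a) = g (D.tgt e) (D.τ e a)) {r : F}
    (hr : D.TreeRelator (fun v x => g v x) r) : r = 0 := by
  induction hr with
  | amalgam e a => exact sub_eq_zero.2 (hg e a)
  | _ => simp

theorem toTreeAlg_apply (v : V) (x : D.vertexAlg v) :
    D.toTreeAlg v x = PresentedLieAlgebra.mk D.treeRelators (FreeLieAlgebra.of k ⟨v, x⟩) := rfl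

theorem toTreeAlg_σ (e : {e : E // e ∈ D.T}) (a : D.edgeAlg e) :
    D.toTreeAlg (D.src e) (D.σ e a) = D.toTreeAlg (D.tgt e) (D.τ e a) :=
  sub_eq_zero.1 (D.mk_of_treeRelator (.amalgam e a))

/-- The universal property of the tree product. -/
noncomputable def treeLift (g : ∀ v, D.vertexAlg v →ₗ⁅k⁆ F)
    (hg : ∀ (e : {e : E // e ∈ D.T}) (a : D.edgeAlg e),
      g (D.src e) (D.σ e a) = g (D.tgt e) (D.τ e a)) : D.TreeAlg →ₗ⁅k⁆ F :=
  PresentedLieAlgebra.lift (FreeLieAlgebra.lift k fun p => g p.1 p.2) fun r hr => by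
    refine TreeRelator.eq_zero hg ?_
    have := TreeRelator.map (FreeLieAlgebra.lift k fun p : Σ v, D.vertexAlg v => g p.1 p.2) hr
    simpa only [FreeLieAlgebra.lift_of_apply] using this

theorem treeLift_toTreeAlg (g : ∀ v, D.vertexAlg v →ₗ⁅k⁆ F)
    (hg : ∀ (e : {e : E // e ∈ D.T}) (a : D.edgeAlg e),
      g (D.src e) (D.σ e a) = g (D.tgt e) (D.τ e a)) (v : V) (x : D.vertexAlg v) :
    D.treeLift g hg (D.toTreeAlg v x) = g v x := by
  rw [treeLift, toTreeAlg_apply, PresentedLieAlgebra.lift_mk, FreeLieAlgebra.lift_of_apply]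

theorem treeAlg_hom_ext {f g : D.TreeAlg →ₗ⁅k⁆ F}
    (h : ∀ v x, f (D.toTreeAlg v x) = g (D.toTreeAlg v x)) : f = g :=
  PresentedLieAlgebra.hom_ext fun p => h p.1 p.2

/-- The canonical homomorphism from the tree product to the fundamental Lie algebra. -/
noncomputable def treeToFundamental : D.TreeAlg →ₗ⁅k⁆ D.FundamentalAlg :=
  PresentedLieAlgebra.lift ((PresentedLieAlgebra.mk D.fundamentalRelators).comp
    (FreeLieAlgebra.lift k fun p => FreeLieAlgebra.of k (Sum.inl p))) fun r hr => by
      refine PresentedLieAlgebra.mk_eq_zero (Or.inl ?_)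
      have := TreeRelator.map (FreeLieAlgebra.lift k fun p : Σ v, D.vertexAlg v =>
        (FreeLieAlgebra.of k (Sum.inl p) :
          FreeLieAlgebra k ((Σ v, D.vertexAlg v) ⊕ {e : E // e ∉ D.T}))) hr
      simp only [FreeLieAlgebra.lift_of_apply] at this
      exact this

theorem treeToFundamental_toTreeAlg (v : V) (x : D.vertexAlg v) :
    D.treeToFundamental (D.toTreeAlg v x) =
      PresentedLieAlgebra.mk D.fundamentalRelators (FreeLieAlgebra.of k (Sum.inl ⟨v, x⟩)) := by
  exact congrArg (PresentedLieAlgebra.mk D.fundamentalRelators)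
    (FreeLieAlgebra.lift_of_apply _ _)

/-- The generator of the fundamental Lie algebra that belongs to an edge outside the forest. -/
noncomputable def stableLetter (e : {e : E // e ∉ D.T}) : D.FundamentalAlg :=
  PresentedLieAlgebra.mk D.fundamentalRelators (FreeLieAlgebra.of k (Sum.inr e))

theorem stableLetter_lie (e : {e : E // e ∉ D.T}) (a : D.edgeAlg e) :
    ⁅D.stableLetter e, D.treeToFundamental (D.toTreeAlg (D.src e) (D.σ e a))⁆ =
      D.treeToFundamental (D.toTreeAlg (D.tgt e) (D.d e a)) := by
  rw [treeToFundamental_toTreeAlg, treeToFundamental_toTreeAlg, stableLetter, ← LieHom.map_lie,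
    ← sub_eq_zero, ← map_sub]
  exact PresentedLieAlgebra.mk_eq_zero (Or.inr ⟨e, a, rfl⟩)

/-- The universal property of the fundamental Lie algebra. -/
noncomputable def fundamentalLift (g : D.TreeAlg →ₗ⁅k⁆ F) (t : {e : E // e ∉ D.T} → F)
    (h : ∀ (e : {e : E // e ∉ D.T}) (a : D.edgeAlg e),
      ⁅t e, g (D.toTreeAlg (D.src e) (D.σ e a))⁆ = g (D.toTreeAlg (D.tgt e) (D.d e a))) :
    D.FundamentalAlg →ₗ⁅k⁆ F :=
  PresentedLieAlgebra.lift
    (FreeLieAlgebra.lift k (Sum.elim (fun p => g (D.toTreeAlg p.1 p.2)) t)) fun r hr => by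
      rcases hr with hr | ⟨e, a, rfl⟩
      · refine TreeRelator.eq_zero (g := fun v => g.comp (D.toTreeAlg v))
          (fun e a => congrArg g (D.toTreeAlg_σ e a)) ?_
        have := TreeRelator.map
          (FreeLieAlgebra.lift k (Sum.elim (fun p => g (D.toTreeAlg p.1 p.2)) t)) hr
        simp only [FreeLieAlgebra.lift_of_apply] at this
        exact this
      · rw [map_sub, LieHom.map_lie, FreeLieAlgebra.lift_of_apply, FreeLieAlgebra.lift_of_apply,
          FreeLieAlgebra.lift_of_apply]
        exact sub_eq_zero.2 (h e a)

variable {D} {g : D.TreeAlg →ₗ⁅k⁆ F} {t : {e : E // e ∉ D.T} → F}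
    {h : ∀ (e : {e : E // e ∉ D.T}) (a : D.edgeAlg e),
      ⁅t e, g (D.toTreeAlg (D.src e) (D.σ e a))⁆ = g (D.toTreeAlg (D.tgt e) (D.d e a))}

theorem fundamentalLift_treeToFundamental (x : D.TreeAlg) :
    D.fundamentalLift g t h (D.treeToFundamental x) = g x := by
  suffices (D.fundamentalLift g t h).comp D.treeToFundamental = g from DFunLike.congr_fun this x
  refine D.treeAlg_hom_ext fun v x => ?_
  rw [LieHom.comp_apply, treeToFundamental_toTreeAlg, fundamentalLift, PresentedLieAlgebra.lift_mk,
    FreeLieAlgebra.lift_of_apply]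
  rfl

theorem fundamentalLift_stableLetter (e : {e : E // e ∉ D.T}) :
    D.fundamentalLift g t h (D.stableLetter e) = t e := by
  rw [fundamentalLift, stableLetter, PresentedLieAlgebra.lift_mk, FreeLieAlgebra.lift_of_apply]
  rfl

variable (D) in
theorem fundamentalAlg_hom_ext {f g : D.FundamentalAlg →ₗ⁅k⁆ F}
    (h : ∀ x, f (D.treeToFundamental x) = g (D.treeToFundamental x))
    (h' : ∀ e, f (D.stableLetter e) = g (D.stableLetter e)) : f = g := by
  refine PresentedLieAlgebra.hom_ext fun p => ?_
  rcases p with p | e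
  · have := h (D.toTreeAlg p.1 p.2)
    rwa [treeToFundamental_toTreeAlg] at this
  · exact h' e

end

open UniversalEnvelopingAlgebra

/-- The elements of `L` whose images lie in the subalgebra form a Lie subalgebra `K`. That `K` is
everything is then seen from the universal property of `L`: a homomorphism `L → K` followed by the
inclusion is the identity. -/
theorem _root_.PBW.adjoin_eq_top {L : Type*} [LieRing L] [LieAlgebra k L]
    {S : Set (UniversalEnvelopingAlgebra k L)}
    (h : ∀ K : LieSubalgebra k L, (∀ x, ι k x ∈ Algebra.adjoin k S → x ∈ K) → K = ⊤) :
    Algebra.adjoin k S = ⊤ := by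
  let K : LieSubalgebra k L :=
    { (Algebra.adjoin k S).toSubmodule.comap (ι k : L →ₗ⁅k⁆ _).toLinearMap with
      lie_mem' := fun {x y} hx hy => by
        change ι k ⁅x, y⁆ ∈ Algebra.adjoin k S
        rw [LieHom.map_lie, Ring.lie_def]
        exact sub_mem (mul_mem hx hy) (mul_mem hy hx) }
  have hK : K = ⊤ := h K fun x hx => hx
  rw [eq_top_iff, ← PBW.adjoin_range_ι]
  refine Algebra.adjoin_le ?_
  rintro _ ⟨x, rfl⟩
  exact (hK ▸ LieSubalgebra.mem_top x : x ∈ K)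

theorem adjoin_iUnion_range_toTreeAlg :
    Algebra.adjoin k (⋃ v, Set.range (PBW.envelopingMap (D.toTreeAlg v))) = ⊤ := by
  refine PBW.adjoin_eq_top fun K hK => ?_
  have hv (v x) : D.toTreeAlg v x ∈ K :=
    hK _ (Algebra.subset_adjoin (Set.mem_iUnion.2 ⟨v, ι k x, PBW.envelopingMap_ι _ _⟩))
  let f : D.TreeAlg →ₗ⁅k⁆ K := D.treeLift
    (fun v => { (D.toTreeAlg v).toLinearMap.codRestrict K.toSubmodule (hv v) with
      map_lie' := fun {x y} => Subtype.ext ((D.toTreeAlg v).map_lie x y) })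
    fun e a => Subtype.ext (D.toTreeAlg_σ e a)
  have hf : K.incl.comp f = LieHom.id := D.treeAlg_hom_ext fun v x => by
    rw [LieHom.comp_apply, D.treeLift_toTreeAlg]
    rfl
  refine eq_top_iff.2 fun x _ => ?_
  have hx : (f x : D.TreeAlg) = x := DFunLike.congr_fun hf x
  exact hx ▸ (f x).2

theorem adjoin_range_treeToFundamental :
    Algebra.adjoin k (Set.range (PBW.envelopingMap D.treeToFundamental) ∪
      Set.range fun e => ι k (D.stableLetter e)) = ⊤ := by
  refine PBW.adjoin_eq_top fun K hK => ?_
  have ht (x) : D.treeToFundamental x ∈ K :=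
    hK _ (Algebra.subset_adjoin (Or.inl ⟨ι k x, PBW.envelopingMap_ι _ _⟩))
  have hs (e) : D.stableLetter e ∈ K := hK _ (Algebra.subset_adjoin (Or.inr ⟨e, rfl⟩))
  let f : D.FundamentalAlg →ₗ⁅k⁆ K := D.fundamentalLift
    { D.treeToFundamental.toLinearMap.codRestrict K.toSubmodule ht with
      map_lie' := fun {x y} => Subtype.ext (D.treeToFundamental.map_lie x y) }
    (fun e => ⟨D.stableLetter e, hs e⟩) fun e a => Subtype.ext (D.stableLetter_lie e a)
  have hf : K.incl.comp f = LieHom.id := D.fundamentalAlg_hom_ext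
    (fun x => by
      rw [LieHom.comp_apply, fundamentalLift_treeToFundamental]
      rfl)
    (fun e => by
      rw [LieHom.comp_apply, fundamentalLift_stableLetter]
      rfl)
  refine eq_top_iff.2 fun x _ => ?_
  have hx : (f x : D.FundamentalAlg) = x := DFunLike.congr_fun hf x
  exact hx ▸ (f x).2

end PreGraphOfLieAlgebras

/-! ### Embedding of the vertex algebras -/

section LeftFree

universe w

variable {k : Type*} [Field k] {A R : Type*} [Ring A] [Ring R] [Algebra k A] [Algebra k R]
  {f : A →ₐ[k] R}

theorem IsLeftFreeAlong.exists_linearEquiv [Nontrivial R] (hf : IsLeftFreeAlong.{w} f) :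
    ∃ ι : Type w, Nonempty ι ∧ Nonempty (ι ↪ R) ∧
      ∃ e : R ≃ₗ[k] (ι →₀ A), ∀ a r, e (f a * r) = a • e r := by
  obtain ⟨ι, b, hb⟩ := hf
  have hA : Nontrivial A := by
    refine ⟨⟨0, 1, fun h => zero_ne_one (α := R) ?_⟩⟩
    rw [← map_one f, ← h, map_zero]
  let F : (ι →₀ A) →ₗ[k] R := Finsupp.lsum k fun i => LinearMap.mulRight k (b i) ∘ₗ f.toLinearMap
  have hF : Function.Bijective F := hb
  have hs (i : ι) (a : A) : F (Finsupp.single i a) = f a * b i := by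
    simp [F]
  have hsmul (a : A) (c : ι →₀ A) : F (a • c) = f a * F c := by
    induction c using Finsupp.induction_linear with
    | zero => simp
    | add c c' h h' => rw [smul_add, map_add, map_add, h, h', mul_add]
    | single i a' => rw [Finsupp.smul_single, hs, hs, smul_eq_mul, map_mul, mul_assoc]
  refine ⟨ι, ?_, ⟨⟨b, fun i j h => ?_⟩⟩, (LinearEquiv.ofBijective F hF).symm, fun a r => ?_⟩
  · by_contra hι
    rw [not_nonempty_iff] at hι
    exact not_subsingleton R hF.2.subsingleton
  · have : F (Finsupp.single i 1) = F (Finsupp.single j 1) := by rw [hs, hs, h]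
    exact Finsupp.single_left_injective one_ne_zero (hF.1 this)
  · rw [LinearEquiv.symm_apply_eq]
    refine Eq.trans ?_ (hsmul _ _).symm
    exact congrArg (f a * ·) ((LinearEquiv.ofBijective F hF).apply_symm_apply r).symm

/-- A free module over `R` of large rank is free of the same rank over `A`. -/
theorem IsLeftFreeAlong.exists_finsupp_linearEquiv {V : Type*} {X : V → Type*} (v : V)
    [Ring (X v)] [Algebra k (X v)] [Nontrivial (X v)] {f : A →ₐ[k] X v}
    (hf : IsLeftFreeAlong.{w} f) :
    ∃ e : ((∀ v, ℕ → X v) →₀ X v) ≃ₗ[k] ((∀ v, ℕ → X v) →₀ A), ∀ a r, e (f a • r) = a • e r := by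
  classical
  obtain ⟨ι, ⟨i₀⟩, ⟨j⟩, e, he⟩ := hf.exists_linearEquiv
  -- Schröder–Bernstein: the basis index embeds in `X v` and can be prepended to the sequence at
  -- `v`, so the index set absorbs it as a factor.
  obtain ⟨φ⟩ : Nonempty ((∀ v, ℕ → X v) × ι ≃ (∀ v, ℕ → X v)) := by
    refine Function.Embedding.antisymm
      ⟨fun p => Function.update p.1 v fun n => n.casesOn (j p.2) (p.1 v), ?_⟩
      ⟨fun x => (x, i₀), fun x y h => congrArg Prod.fst h⟩
    rintro ⟨x, i⟩ ⟨y, i'⟩ h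
    have h' (u : V) := congrFun h u
    have hv := h' v
    simp only [Function.update_self] at hv
    have hi : i = i' := j.injective (congrFun hv 0)
    refine Prod.ext (funext fun u => ?_) hi
    by_cases hu : u = v
    · subst hu
      exact funext fun n => congrFun hv (n + 1)
    · simpa [hu] using h' u
  refine ⟨(Finsupp.mapRange.linearEquiv e).trans
    ((Finsupp.curryLinearEquiv k).symm.trans (Finsupp.domLCongr φ)), fun a r => ?_⟩
  ext x
  simp [he, Finsupp.uncurry_apply]

theorem isLeftFreeAlong_ofId.{ur} {k : Type*} [Field k] {R : Type ur} [Ring R] [Algebra k R] :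
    IsLeftFreeAlong.{ur} (Algebra.ofId k R) := by
  let b := Module.Basis.ofVectorSpace k R
  refine ⟨_, b, ?_⟩
  convert b.repr.symm.bijective using 2 with c
  simp [Module.Basis.repr_symm_apply, Finsupp.linearCombination_apply, Algebra.smul_def,
    Algebra.ofId_apply]

/-- A derivation along `f` extends to an operator on `R` that satisfies the Leibniz rule. -/
theorem IsLeftFreeAlong.exists_leibniz (hf : IsLeftFreeAlong.{w} f) (δ : A →ₗ[k] R)
    (hδ : ∀ a a', δ (a * a') = f a * δ a' + δ a * f a') :
    ∃ D : R →ₗ[k] R, ∀ a r, D (f a * r) = f a * D r + δ a * r := by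
  obtain ⟨ι, b, hb⟩ := hf
  let F : (ι →₀ A) →ₗ[k] R := Finsupp.lsum k fun i => LinearMap.mulRight k (b i) ∘ₗ f.toLinearMap
  have hF : Function.Bijective F := hb
  have hs (i : ι) (a : A) : F (Finsupp.single i a) = f a * b i := by
    simp [F]
  -- The operator applies `δ` to the coefficients with respect to a left basis; its Leibniz rule is
  -- that of `δ`.
  let F' : (ι →₀ A) →ₗ[k] R := Finsupp.lsum k fun i => LinearMap.mulRight k (b i) ∘ₗ δ
  have hs' (i : ι) (a : A) : F' (Finsupp.single i a) = δ a * b i := by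
    simp [F']
  have hD (c) : (F' ∘ₗ (LinearEquiv.ofBijective F hF).symm.toLinearMap) (F c) = F' c :=
    congrArg F' ((LinearEquiv.ofBijective F hF).symm_apply_apply c)
  refine ⟨F' ∘ₗ (LinearEquiv.ofBijective F hF).symm.toLinearMap, fun a r => ?_⟩
  obtain ⟨c, rfl⟩ := hF.2 r
  generalize F' ∘ₗ (LinearEquiv.ofBijective F hF).symm.toLinearMap = D at hD
  induction c using Finsupp.induction_linear with
  | zero => simp
  | add c c' h h' =>
    rw [map_add, mul_add, map_add, h, h', map_add, mul_add, mul_add]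
    abel
  | single i a' =>
    have : f a * F (Finsupp.single i a') = F (Finsupp.single i (a * a')) := by
      rw [hs, hs, map_mul, mul_assoc]
    rw [this, hD, hD, hs, hs', hs', hδ, add_mul, mul_assoc, mul_assoc]

end LeftFree

namespace PreGraphOfLieAlgebras

open UniversalEnvelopingAlgebra

variable {k : Type uk} [Field k] {V : Type uV} {E : Type uE}
  (D : PreGraphOfLieAlgebras.{uk, uV, uE, uL, uM} k V E)

/-- The vertex algebras embed into the tree product. -/
theorem toTreeAlg_injective [Finite E] (v : V) : Function.Injective (D.toTreeAlg v) := by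
  classical
  let U (v : V) := UniversalEnvelopingAlgebra k (D.vertexAlg v)
  let κ := ∀ v, ℕ → U v
  let W := κ →₀ k
  have hΘ (v : V) : Nonempty ((κ →₀ U v) ≃ₗ[k] W) :=
    let ⟨e, _⟩ := IsLeftFreeAlong.exists_finsupp_linearEquiv (X := U) v
      (isLeftFreeAlong_ofId (k := k) (R := U v))
    ⟨e⟩
  let Θ (v : V) : (κ →₀ U v) ≃ₗ[k] W := (hΘ v).some
  have hσ (e : {e : E // e ∈ D.T}) := IsLeftFreeAlong.exists_finsupp_linearEquiv (X := U) (D.src e)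
    (PBW.isLeftFreeAlong_envelopingMap (D.σ e) (D.σ_injective e))
  have hτ (e : {e : E // e ∈ D.T}) := IsLeftFreeAlong.exists_finsupp_linearEquiv (X := U) (D.tgt e)
    (PBW.isLeftFreeAlong_envelopingMap (D.τ e) (D.τ_injective e))
  choose σ' hσ' using hσ
  choose τ' hτ' using hτ
  -- Large free modules over the vertex enveloping algebras are all identified with `W`. Along an
  -- edge of the forest both are free of the same rank over the edge algebra; solving over the
  -- forest in the group of automorphisms of `W` makes the two actions of that algebra coincide.
  obtain ⟨g, hg⟩ := D.isMaximalForest.prop.solvable (Set.toFinite _) (W ≃ₗ[k] W) fun e =>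
    if he : e ∈ D.T then
      ((Θ (D.src e)).symm.trans (σ' ⟨e, he⟩)).trans ((τ' ⟨e, he⟩).symm.trans (Θ (D.tgt e)))
    else 1
  let ρ (v : V) : U v →ₐ[k] Module.End k W :=
    (((Θ v).trans (g v)).conjAlgEquiv k).toAlgHom.comp (Algebra.lsmul k k (κ →₀ U v))
  have hρ (v : V) (u : U v) (w : κ →₀ U v) : ρ v u (g v (Θ v w)) = g v (Θ v (u • w)) := by
    simp [ρ, LinearEquiv.conjAlgEquiv_apply]
  let φ := D.treeLift (F := Module.End k W)
      (fun v => (ρ v : U v →ₗ⁅k⁆ Module.End k W).comp (ι k)) fun e a => by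
    have hge := hg e e.2
    rw [dif_pos e.2] at hge
    have hge' (w : κ →₀ UniversalEnvelopingAlgebra k (D.edgeAlg e)) :
        g (D.src e) (Θ (D.src e) ((σ' e).symm w)) = g (D.tgt e) (Θ (D.tgt e) ((τ' e).symm w)) := by
      rw [hge]
      simp
    refine LinearMap.ext fun w => ?_
    obtain ⟨w, rfl⟩ := (((σ' e).symm.trans (Θ (D.src e))).trans (g (D.src e))).surjective w
    have h₁ : (σ' e).symm (ι k a • w) = ι k (D.σ e a) • (σ' e).symm w := by
      rw [LinearEquiv.symm_apply_eq, ← PBW.envelopingMap_ι, hσ', LinearEquiv.apply_symm_apply]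
    have h₂ : (τ' e).symm (ι k a • w) = ι k (D.τ e a) • (τ' e).symm w := by
      rw [LinearEquiv.symm_apply_eq, ← PBW.envelopingMap_ι, hτ', LinearEquiv.apply_symm_apply]
    change ρ _ (ι k (D.σ e a)) (g (D.src e) (Θ (D.src e) ((σ' e).symm w))) =
      ρ _ (ι k (D.τ e a)) (g (D.src e) (Θ (D.src e) ((σ' e).symm w)))
    rw [hρ, ← h₁, hge', hge', hρ, h₂]
  rw [injective_iff_map_eq_zero]
  intro x hx
  have h₁ : ρ v (ι k x) = 0 :=
    (D.treeLift_toTreeAlg _ _ v x).symm.trans ((congrArg φ hx).trans (map_zero φ))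
  -- Acting on a basis vector of the free module recovers `ι k x`, so the action of the vertex
  -- algebra is faithful.
  have h₂ := hρ v (ι k x) (Finsupp.single (fun _ _ => 0) 1)
  rw [h₁, LinearMap.zero_apply, eq_comm, LinearEquiv.map_eq_zero_iff, LinearEquiv.map_eq_zero_iff,
    Finsupp.smul_single, Finsupp.single_eq_zero, smul_eq_mul, mul_one] at h₂
  exact PBW.ι_injective (h₂.trans (map_zero _).symm)

end PreGraphOfLieAlgebras

/-- A derivation along `f` is the second component of a homomorphism to the trivial square-zero
extension with first component induced by `f`, so the universal property of the enveloping algebra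
extends `d`. -/
theorem PBW.exists_derivation {k : Type*} [Field k] {H L : Type*} [LieRing H] [LieAlgebra k H]
    [LieRing L] [LieAlgebra k L] (f : H →ₗ⁅k⁆ L) (d : H →ₗ[k] L)
    (hd : ∀ a b, d ⁅a, b⁆ = ⁅f a, d b⁆ + ⁅d a, f b⁆) :
    ∃ δ : UniversalEnvelopingAlgebra k H →ₗ[k] UniversalEnvelopingAlgebra k L,
      (∀ a, δ (UniversalEnvelopingAlgebra.ι k a) = UniversalEnvelopingAlgebra.ι k (d a)) ∧
      ∀ a b, δ (a * b) = envelopingMap f a * δ b + δ a * envelopingMap f b := by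
  let U := UniversalEnvelopingAlgebra k L
  let ι' := UniversalEnvelopingAlgebra.ι k (L := L)
  let g : H →ₗ⁅k⁆ TrivSqZeroExt U U :=
    { toFun := fun a => TrivSqZeroExt.inl (ι' (f a)) + TrivSqZeroExt.inr (ι' (d a))
      map_add' := fun a b => by
        ext <;> simp
      map_smul' := fun c a => by
        ext <;> simp
      map_lie' := fun {a b} => by
        rw [Ring.lie_def]
        ext
        · simp [Ring.lie_def]
        · simp [Ring.lie_def, hd]
          abel }
  let G := UniversalEnvelopingAlgebra.lift k g
  have hG (a) : G (UniversalEnvelopingAlgebra.ι k a) = g a :=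
    UniversalEnvelopingAlgebra.lift_ι_apply _ _ _
  have hfst : (TrivSqZeroExt.fstHom k U U).comp G = envelopingMap f := by
    refine UniversalEnvelopingAlgebra.hom_ext k (LieHom.ext fun a => ?_)
    change (G (UniversalEnvelopingAlgebra.ι k a)).fst =
      envelopingMap f (UniversalEnvelopingAlgebra.ι k a)
    rw [hG, envelopingMap_ι]
    simp [g, ι']
  refine ⟨(TrivSqZeroExt.sndHom U U).restrictScalars k ∘ₗ G.toLinearMap, fun a => ?_, fun a b => ?_⟩
  · change (G (UniversalEnvelopingAlgebra.ι k a)).snd = _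
    rw [hG]
    simp [g, ι']
  · change (G (a * b)).snd = _ * (G b).snd + (G a).snd * _
    rw [map_mul, TrivSqZeroExt.snd_mul, ← hfst]
    rfl

namespace GraphOfLieAlgebras

open UniversalEnvelopingAlgebra

variable {k : Type uk} [Field k] {V : Type uV} {E : Type uE}
  (D : GraphOfLieAlgebras.{uk, uV, uE, uL, uM} k V E)

/-- The tree product embeds into the fundamental Lie algebra. -/
theorem treeToFundamental_injective [Finite E] : Function.Injective D.treeToFundamental := by
  let U := UniversalEnvelopingAlgebra k D.TreeAlg
  -- The operators by which the stable letters act on `U(L_T)`: their commutator with left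
  -- multiplication by `σ_e(a)` is left multiplication by `d_e(a)`, as the relators of `L` demand.
  have ht (e : {e : E // e ∉ D.T}) : ∃ t : Module.End k U, ∀ a r,
      t (ι k (D.toTreeAlg (D.src e) (D.σ e a)) * r) =
        ι k (D.toTreeAlg (D.src e) (D.σ e a)) * t r +
          ι k (D.toTreeAlg (D.tgt e) (D.d e a)) * r := by
    obtain ⟨δ, hδ, hδ'⟩ := PBW.exists_derivation ((D.toTreeAlg (D.src e)).comp (D.σ e))
      ((D.toTreeAlg (D.tgt e)).toLinearMap ∘ₗ D.d e) (D.d_lie e)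
    obtain ⟨t, ht⟩ := (PBW.isLeftFreeAlong_envelopingMap
      ((D.toTreeAlg (D.src e)).comp (D.σ e))
      ((D.toTreeAlg_injective _).comp (D.σ_injective _))).exists_leibniz δ hδ'
    refine ⟨t, fun a r => ?_⟩
    have := ht (ι k a) r
    rwa [hδ, PBW.envelopingMap_ι] at this
  choose t ht using ht
  let g : D.TreeAlg →ₗ⁅k⁆ Module.End k U :=
    (Algebra.lmul k U : U →ₗ⁅k⁆ Module.End k U).comp (ι k)
  let φ := D.fundamentalLift g t fun e a => by
    rw [Ring.lie_def]
    refine LinearMap.ext fun r => ?_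
    exact sub_eq_iff_eq_add'.2 (ht e a r)
  rw [injective_iff_map_eq_zero]
  intro x hx
  have h₁ : g x = 0 :=
    (PreGraphOfLieAlgebras.fundamentalLift_treeToFundamental x).symm.trans
      ((congrArg φ hx).trans (map_zero φ))
  have h₂ : ι k x * 1 = 0 := LinearMap.congr_fun h₁ (1 : U)
  rw [mul_one] at h₂
  exact PBW.ι_injective (h₂.trans (map_zero _).symm)

end GraphOfLieAlgebras

/-! ### Coherence of the enveloping algebra -/

theorem isRightNoetherianRing_of_field (k : Type*) [Field k] : IsRightNoetherianRing k :=
  isNoetherian_of_linearEquiv (opRegularEquiv k).symm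

namespace PBW

open UniversalEnvelopingAlgebra

variable {k : Type*} [Field k] {H L : Type*} [LieRing H] [LieAlgebra k H] [LieRing L]
  [LieAlgebra k L]

theorem range_envelopingMap_comp_subset {L' : Type*} [LieRing L'] [LieAlgebra k L']
    (g : L →ₗ⁅k⁆ L') (f : H →ₗ⁅k⁆ L) :
    Set.range (envelopingMap (g.comp f)) ⊆ Set.range (envelopingMap g) := by
  have h : envelopingMap (g.comp f) = (envelopingMap g).comp (envelopingMap f) := by
    refine UniversalEnvelopingAlgebra.hom_ext k (LieHom.ext fun x => ?_)
    change envelopingMap (g.comp f) (ι k x) = envelopingMap g (envelopingMap f (ι k x))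
    rw [envelopingMap_ι, envelopingMap_ι, envelopingMap_ι, LieHom.comp_apply]
  rw [h]
  rintro _ ⟨x, rfl⟩
  exact ⟨envelopingMap f x, rfl⟩

/-- If the commutators with `r` of the generators of a subalgebra lie in a larger subalgebra, then
so do the commutators of all its elements. -/
theorem commutator_mem {R : Type*} [Ring R] [Algebra k R]
    (f : UniversalEnvelopingAlgebra k H →ₐ[k] R)
    (C : Subalgebra k R) (hf : Set.range f ⊆ C) {r : R}
    (h : ∀ a, r * f (ι k a) - f (ι k a) * r ∈ C) (u : UniversalEnvelopingAlgebra k H) :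
    r * f u - f u * r ∈ C := by
  have hu : u ∈ Algebra.adjoin k (Set.range (ι k : H → UniversalEnvelopingAlgebra k H)) :=
    adjoin_range_ι (k := k) (L := H) ▸ trivial
  induction hu using Algebra.adjoin_induction with
  | mem _ hx =>
    obtain ⟨a, rfl⟩ := hx
    exact h a
  | algebraMap c =>
    rw [AlgHom.commutes, Algebra.commutes, sub_self]
    exact zero_mem _
  | add x y _ _ hx hy =>
    rw [map_add, mul_add, add_mul, add_sub_add_comm]
    exact add_mem hx hy
  | mul x y _ _ hx hy =>
    have : r * f (x * y) - f (x * y) * r =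
        (r * f x - f x * r) * f y + f x * (r * f y - f y * r) := by
      rw [map_mul]
      noncomm_ring
    rw [this]
    exact add_mem (mul_mem hx (hf ⟨y, rfl⟩)) (mul_mem (hf ⟨x, rfl⟩) hy)

end PBW

namespace PreGraphOfLieAlgebras

open UniversalEnvelopingAlgebra

variable {k : Type uk} [Field k] {V : Type uV} {E : Type uE}
  (D : PreGraphOfLieAlgebras.{uk, uV, uE, uL, uM} k V E)

/-- Twisting a homomorphism on the vertex algebras by inner automorphisms. -/
theorem exists_twist {B : Type*} [Ring B] [Algebra k B]
    (d : UniversalEnvelopingAlgebra k D.TreeAlg →ₐ[k] B) (s : V → Bˣ)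
    (hs : ∀ (e : {e : E // e ∈ D.T}) (a : D.edgeAlg e),
      Commute (s (D.src e) * (s (D.tgt e))⁻¹).val
        (d (ι k (D.toTreeAlg (D.src e) (D.σ e a))))) :
    ∃ ρ : UniversalEnvelopingAlgebra k D.TreeAlg →ₐ[k] B,
      ∀ v, ∀ c ∈ Set.range (PBW.envelopingMap (D.toTreeAlg v)),
        ρ c = ((s v)⁻¹).val * d c * (s v).val := by
  let conj (v : V) : B →ₐ[k] B := MulSemiringAction.toAlgHom k B (ConjAct.toConjAct (s v)⁻¹)
  have hconj (v : V) (x : B) : conj v x = ((s v)⁻¹).val * x * (s v).val := by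
    change ConjAct.toConjAct (s v)⁻¹ • x = _
    rw [ConjAct.units_smul_def, ConjAct.ofConjAct_toConjAct, inv_inv]
  let ρ' (v : V) : UniversalEnvelopingAlgebra k (D.vertexAlg v) →ₐ[k] B :=
    ((conj v).comp d).comp (PBW.envelopingMap (D.toTreeAlg v))
  have hρ' (v : V) (x : D.vertexAlg v) : ρ' v (ι k x) =
      ((s v)⁻¹).val * d (ι k (D.toTreeAlg v x)) * (s v).val := by
    change conj v (d (PBW.envelopingMap (D.toTreeAlg v) (ι k x))) = _
    rw [hconj, PBW.envelopingMap_ι]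
  have hρ (e : {e : E // e ∈ D.T}) (a : D.edgeAlg e) :
      ρ' (D.src e) (ι k (D.σ e a)) = ρ' (D.tgt e) (ι k (D.τ e a)) := by
    rw [hρ', hρ', ← toTreeAlg_σ]
    have h := (hs e a).eq
    generalize d (ι k (D.toTreeAlg (D.src e) (D.σ e a))) = x at h
    rw [mul_assoc, Units.inv_mul_eq_iff_eq_mul]
    rw [Units.val_mul] at h
    calc x * (s (D.src e)).val
        = x * ((s (D.src e)).val * ((s (D.tgt e))⁻¹).val) * (s (D.tgt e)).val := by
          simp [mul_assoc]
      _ = _ := by rw [← h]; simp only [mul_assoc]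
  let φ := D.treeLift (F := B) (fun v => ((ρ' v).toLieHom).comp (ι k)) hρ
  refine ⟨UniversalEnvelopingAlgebra.lift k φ, fun v => ?_⟩
  have h : (UniversalEnvelopingAlgebra.lift k φ).comp (PBW.envelopingMap (D.toTreeAlg v)) =
      ρ' v := by
    refine UniversalEnvelopingAlgebra.hom_ext k (LieHom.ext fun x => ?_)
    change UniversalEnvelopingAlgebra.lift k φ (PBW.envelopingMap (D.toTreeAlg v) (ι k x)) =
      ρ' v (ι k x)
    rw [PBW.envelopingMap_ι, UniversalEnvelopingAlgebra.lift_ι_apply]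
    exact D.treeLift_toTreeAlg _ _ v x
  rintro _ ⟨u, rfl⟩
  exact (DFunLike.congr_fun h u).trans (hconj v _)

/-- The universal enveloping algebra of the tree product is right coherent. -/
theorem isRightCoherentRing_treeAlg [Finite V] [Finite E]
    (hV : ∀ v : V, IsRightCoherentRing (UniversalEnvelopingAlgebra k (D.vertexAlg v)))
    (hE : ∀ e : E, IsRightNoetherianRing (UniversalEnvelopingAlgebra k (D.edgeAlg e))) :
    IsRightCoherentRing (UniversalEnvelopingAlgebra k D.TreeAlg) := by
  classical
  have := Fintype.ofFinite V
  have := Fintype.ofFinite E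
  obtain ⟨S, hTS, hST, hS, hj⟩ := OrientedGraph.exists_connected_extension D.toOrientedGraph
    (D.isMaximalForest.prop.solvable (Set.toFinite _))
  let R := UniversalEnvelopingAlgebra k D.TreeAlg
  -- The edges added to make the forest a tree carry the base field as edge ring, which accounts for
  -- free products over different components.
  let A : E ⊕ V × V → Set R := Sum.elim
    (fun e => Set.range (PBW.envelopingMap ((D.toTreeAlg (D.src e)).comp (D.σ e))))
    fun _ => Set.range (Algebra.ofId k R)
  have hk (v : V) : Set.range (Algebra.ofId k R) ⊆
      Set.range (PBW.envelopingMap (D.toTreeAlg v)) := by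
    rintro _ ⟨c, rfl⟩
    exact ⟨algebraMap k _ c, AlgHom.commutes _ c⟩
  refine BalancedReflecting.isRightCoherentRing (k := k) <|
    BalancedReflecting.of_tree (fun e : S => D.complete.src e) (fun e : S => D.complete.tgt e)
    (fun v => Set.range (PBW.envelopingMap (D.toTreeAlg v))) (fun e : S => A e)
    D.adjoin_iUnion_range_toTreeAlg (fun v => ?_) ?_ ?_ ?_ ?_ ?_
  · exact (hV v).balancedReflecting
      (PBW.isLeftFreeAlong_envelopingMap _ (D.toTreeAlg_injective v))
      (PBW.isRightFreeAlong_envelopingMap _ (D.toTreeAlg_injective v))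
  · rintro ⟨e | p, he⟩
    · exact (hE e).balancedComponentwise (PBW.isLeftFreeAlong_envelopingMap _
        ((D.toTreeAlg_injective _).comp (D.σ_injective e)))
    · exact (isRightNoetherianRing_of_field k).balancedComponentwise isLeftFreeAlong_ofId
  · rintro ⟨e | p, he⟩
    · exact PBW.range_envelopingMap_comp_subset _ _
    · exact hk _
  · rintro ⟨e | p, he⟩
    · have h : (D.toTreeAlg (D.src e)).comp (D.σ e) =
          (D.toTreeAlg (D.tgt e)).comp (D.τ ⟨e, hST e he⟩) :=
        LieHom.ext fun a => D.toTreeAlg_σ ⟨e, hST e he⟩ a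
      change Set.range (PBW.envelopingMap ((D.toTreeAlg (D.src e)).comp (D.σ e))) ⊆ _
      rw [h]
      exact PBW.range_envelopingMap_comp_subset _ _
    · exact hk _
  · intro W _ y hy
    exact OrientedGraph.exists_eq_boundary hj y hy
  · intro M _ _ _ _ e₀
    -- Solved in the additive group of linear maps: the shears at the two ends of an edge agree,
    -- except that at `e₀` they differ by `m ↦ m ⊗ 1`. Since this map commutes with the edge
    -- algebra, the conjugated actions still agree along the forest.
    obtain ⟨g, hg⟩ := hS (Multiplicative (M →ₗ[k] BalancedTensor k (A e₀) M))
      fun e => if e = e₀ then Multiplicative.ofAdd (BalancedTensor.of (A e₀) M) else 1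
    have hq (e : S) (he : e ≠ e₀) :
        (g (D.complete.src e)).toAdd = (g (D.complete.tgt e)).toAdd := by
      rw [hg e e.2, if_neg (Subtype.coe_injective.ne he), mul_one]
    have hq₀ : (g (D.complete.src e₀)).toAdd =
        (g (D.complete.tgt e₀)).toAdd + BalancedTensor.of (A e₀) M := by
      rw [hg e₀ e₀.2, if_pos rfl]
      rfl
    obtain ⟨ρ, hρ⟩ := D.exists_twist (diagonalAction (A e₀) M)
      (fun v => shear (g v).toAdd) fun e a => by
        have he : (g (D.src e)).toAdd = (if (Sum.inl e.1 : E ⊕ V × V) = e₀ then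
            BalancedTensor.of (A e₀) M else 0) + (g (D.tgt e)).toAdd := by
          refine (congrArg Multiplicative.toAdd (hg (Sum.inl e) (hTS ⟨e, e.2, rfl⟩))).trans ?_
          rw [toAdd_mul, add_comm]
          split_ifs <;> rfl
        rw [he, shear_add, mul_inv_cancel_right]
        refine (Commute.one_left _).add_left (shearPart_commute fun m => ?_)
        split_ifs with h
        · refine BalancedTensor.of_smul ?_ m
          rw [← h]
          exact ⟨ι k a, PBW.envelopingMap_ι _ _⟩
        · simp
    exact exists_separating_of_conj D.adjoin_iUnion_range_toTreeAlg e₀ ρ _ hρ hq hq₀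

/-- Changing the images of the stable letters by elements that commute with the edge algebras. -/
theorem exists_perturbation {B : Type*} [Ring B] [Algebra k B]
    (d : UniversalEnvelopingAlgebra k D.FundamentalAlg →ₐ[k] B) (s : {e : E // e ∉ D.T} → B)
    (hs : ∀ (e : {e : E // e ∉ D.T}) (a : D.edgeAlg e), Commute (s e)
      (d (ι k (D.treeToFundamental (D.toTreeAlg (D.src e) (D.σ e a)))))) :
    ∃ ρ : UniversalEnvelopingAlgebra k D.FundamentalAlg →ₐ[k] B,
      (∀ c ∈ Set.range (PBW.envelopingMap D.treeToFundamental), ρ c = d c) ∧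
      ∀ e, ρ (ι k (D.stableLetter e)) = d (ι k (D.stableLetter e)) + s e := by
  let d' : D.FundamentalAlg →ₗ⁅k⁆ B := d.toLieHom.comp (ι k)
  let φ := D.fundamentalLift (d'.comp D.treeToFundamental)
    (fun e => d' (D.stableLetter e) + s e) fun e a => by
      have h := congrArg d' (D.stableLetter_lie e a)
      rw [LieHom.map_lie] at h
      rw [add_lie]
      exact (congrArg₂ (· + ·) h (hs e a).lie_eq).trans (add_zero _)
  refine ⟨UniversalEnvelopingAlgebra.lift k φ, ?_, fun e => ?_⟩
  · have h : (UniversalEnvelopingAlgebra.lift k φ).comp (PBW.envelopingMap D.treeToFundamental) =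
        d.comp (PBW.envelopingMap D.treeToFundamental) := by
      refine UniversalEnvelopingAlgebra.hom_ext k (LieHom.ext fun x => ?_)
      change UniversalEnvelopingAlgebra.lift k φ (PBW.envelopingMap D.treeToFundamental (ι k x)) =
        d (PBW.envelopingMap D.treeToFundamental (ι k x))
      rw [PBW.envelopingMap_ι, UniversalEnvelopingAlgebra.lift_ι_apply]
      exact fundamentalLift_treeToFundamental x
    rintro _ ⟨u, rfl⟩
    exact DFunLike.congr_fun h u
  · rw [UniversalEnvelopingAlgebra.lift_ι_apply]
    exact fundamentalLift_stableLetter e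

end PreGraphOfLieAlgebras

open UniversalEnvelopingAlgebra in
/-- The universal enveloping algebra of the fundamental Lie algebra of a graph of Lie algebras is
right coherent if those of the vertex algebras are right coherent and those of the edge algebras are
right Noetherian. -/
theorem theoremC {k : Type uk} [Field k] {V : Type uV} {E : Type uE} [Finite V] [Finite E]
    (D : GraphOfLieAlgebras.{uk, uV, uE, uL, uM} k V E)
    (hV : ∀ v : V, IsRightCoherentRing (UniversalEnvelopingAlgebra k (D.vertexAlg v)))
    (hE : ∀ e : E, IsRightNoetherianRing (UniversalEnvelopingAlgebra k (D.edgeAlg e))) :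
    IsRightCoherentRing (UniversalEnvelopingAlgebra k D.FundamentalAlg) := by
  classical
  have := Fintype.ofFinite E
  have hinj := D.treeToFundamental_injective
  let R := UniversalEnvelopingAlgebra k D.FundamentalAlg
  let j (e : {e : E // e ∉ D.T}) : D.edgeAlg e →ₗ⁅k⁆ D.FundamentalAlg :=
    D.treeToFundamental.comp ((D.toTreeAlg (D.src e)).comp (D.σ e))
  let A (e : {e : E // e ∉ D.T}) : Set R := Set.range (PBW.envelopingMap (j e))
  have hA (e : {e : E // e ∉ D.T}) (a : D.edgeAlg e) :
      ι k (D.treeToFundamental (D.toTreeAlg (D.src e) (D.σ e a))) ∈ A e :=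
    ⟨ι k a, PBW.envelopingMap_ι (j e) a⟩
  have hj (e) : Function.Injective (j e) :=
    hinj.comp ((D.toTreeAlg_injective _).comp (D.σ_injective _))
  refine BalancedReflecting.isRightCoherentRing (k := k) <|
    BalancedReflecting.of_stableLetters (Set.range (PBW.envelopingMap D.treeToFundamental))
      A (fun e => ι k (D.stableLetter e))
      D.adjoin_range_treeToFundamental ?_ (fun e => ?_) (fun e => ?_) (fun e => ?_) ?_
  · exact (D.isRightCoherentRing_treeAlg hV hE).balancedReflecting
      (PBW.isLeftFreeAlong_envelopingMap _ hinj) (PBW.isRightFreeAlong_envelopingMap _ hinj)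
  · exact (hE e).balancedComponentwise (PBW.isLeftFreeAlong_envelopingMap _ (hj e))
  · exact PBW.range_envelopingMap_comp_subset _ _
  · rintro _ ⟨u, rfl⟩
    -- The commutator with the stable letter need only be checked on `ι k a`, where the relator of
    -- `L` gives `d_e(a)`.
    refine PBW.commutator_mem (PBW.envelopingMap (j e)) (PBW.envelopingMap D.treeToFundamental).range
      (PBW.range_envelopingMap_comp_subset _ _) (fun a => ?_) u
    refine ⟨ι k (D.toTreeAlg (D.tgt e) (D.d e a)), ?_⟩
    have h := congrArg (ι k) (D.stableLetter_lie e a)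
    rw [LieHom.map_lie, Ring.lie_def] at h
    change PBW.envelopingMap D.treeToFundamental (ι k _) = _
    rw [PBW.envelopingMap_ι, PBW.envelopingMap_ι, ← h]
    rfl
  · intro M _ _ _ _ e₀
    -- Only the letter of `e₀` is changed. The added nilpotent map commutes with the edge algebra,
    -- so the relators continue to hold.
    obtain ⟨ρ, hρ, hρ'⟩ := D.exists_perturbation (diagonalAction (A e₀) M)
      (fun e => if e = e₀ then shearPart (BalancedTensor.of (A e₀) M) else 0) fun e a => by
        split_ifs with h
        · exact shearPart_commute fun m => BalancedTensor.of_smul (h ▸ hA e a) m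
        · exact Commute.zero_left _
    refine exists_separating_of_add D.adjoin_range_treeToFundamental e₀ ρ hρ (fun e he => ?_) ?_
    · rw [hρ', if_neg he, add_zero]
    · rw [hρ', if_pos rfl]
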